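/- **Setting.** Let $K\ge 1$, $\mathcal K=\{0,\dots,K-1\}$, and consider a $K$-armed bandit in which pulling arm $a$ gives a reward with law $\nu_a$, mean $\mu_a$, $1$-subGaussian about its mean; the best arm $a^\star$ is unique, $\Delta_a=\mu_{a^\star}-\mu_a$, and $\delta\in(0,1)$. Put $\beta(t)=\sqrt{2\log(8Kt^2/\delta)/t}$. *Clean phased successive elimination (SE).* Start with $S_1=\mathcal K$. While $|S_r|>1$, in phase $r=1,2,\dots$ pull each arm of $S_r$ exactly $m_r=2^{r-1}$ times, and let $\widehat\mu_a$ be the mean of all $t_r=2^r-1$ rewards of $a\in S_r$ so far; then $S_{r+1}=\{a\in S_r:\widehat\mu_a+\beta(t_r)\ge\max_{b\in S_r}(\widehat\mu_b-\beta(t_r))\}$. Let $N_{\rm SE}(\delta,\mu)$ be the largest number of pulls SE makes on the event $\{|\widehat\mu_a(t)-\mu_a|\le\beta(t)\ \forall a,\ \forall t\ge1\}$, where $\widehat\mu_a(t)$ is the mean of the first $t$ rewards of arm $a$. *Packetized SE (PSE).* Arm commands are sent over the one-sided typewriter channel: an input $x\in\mathcal K$ is received as $x$ with probability $1-\varepsilon$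 and as $x+1 \bmod K$ with probability $\varepsilon\in(0,1)$, independently over rounds and independently of the rewards. Each round is one channel use and one pull. In phase $r$ the learner first transmits, in $n_r$ rounds, a packet encoding the plan "pull each arm of $S_r$ exactly $m_r$ times", while the agent keeps pulling its current arm (initially an arbitrary one, later the last arm of the previous phase) and the rewards are discarded; then the agent executes the plan it decoded, and the learner, which sees only the rewards, counts these and eliminates arms as in SE. It stops when one arm is left and returns it. Let $\tau$ be the total number of rounds and $R$ the number of executed phases. The plan family is $\mathcal P_r=\{\mathrm{plan}(S,m_r):\emptyset\ne S\subseteq\mathcal K\}$, with its elements numbered from $0$ in an arbitrary way; a packet is the sequence of the base-$b$ digits of the number of the plan. **Claim.** (a) There is a universal constant $C>0$ such that, for all $K$, $\delta$, $\mu$ as above, $$N_{\rm SE}(\delta,\mu)\le C\sum_{a\ne a^\star}\bigl(1+\Delta_a^{-2}\bigr)\,\log\bigl(e+\tfrac1{\Delta_a}\bigr)\,\log\frac{K\log(e+1/\Delta_a)}{\delta},$$ and SE, run on independent rewards with laws $\nu_a$, makes at most $N_{\rm SE}(\delta,\mu)$ pulls with probability at least $1-\delta$. (b) Let $K=5$.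 For every $\varepsilon\in(0,1)$ the confusability graph of the channel is the cycle $C_5$, and $|\mathcal P_r|\le 2^5-1$. Sending the $\lceil\log_5|\mathcal P_r|\rceil$ base-$5$ digits $d$ of the plan number by the length-2 slope code $d\mapsto(d,2d \bmod 5)$ gives a packet that is decoded with zero error; so $|\mathcal P_r|\le\alpha(C_5^{\boxtimes n_r})$ (independence number of the strong power), and its length satisfies $$n_r=2\lceil\log_5|\mathcal P_r|\rceil\le 2\lceil\log_5 2^5\rceil=6.$$ With these packets, with probability at least $1-\delta$, PSE stops, returns $a^\star$, and $\tau\le N_{\rm SE}(\delta,\mu)+6R$. (c) Let $K=6$. For every $\varepsilon\in(0,1)$ the confusability graph is $C_6$, and $|\mathcal P_r|\le 2^6-1$. Use the public calendar in which only $\{0,2,4\}$ may be transmitted in odd rounds and only $\{1,3,5\}$ in even rounds (for packet symbols), so that each use conveys one ternary digit. Sending the $\lceil\log_3|\mathcal P_r|\rceil$ ternary digits of the plan number in this way gives a packet that respects the calendar and is decoded with zero error whatever the round in which it starts; so $|\mathcal P_r|\le\alpha(C_6^{\boxtimes n_r})$, and $$n_r=\lceil\log_3|\mathcal P_r|\rceil\le\lceil\log_3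 2^6\rceil=4.$$ With these packets, with probability at least $1-\delta$, PSE stops, returns $a^\star$, and $\tau\le N_{\rm SE}(\delta,\mu)+4R$. -/

import Mathlib

open MeasureTheory ProbabilityTheory
open scoped ENNReal

noncomputable section

namespace PSE

/-! ### Channels, confusability, zero-error packets -/

/-- The one-sided typewriter channel on `{0, …, K-1}`: the input `x` is received as `x` with
probability `1 - ε` and as `x + 1 (mod K)` with probability `ε`.  `typewriter K ε x y` is the
transition probability `W(y | x)`. -/
def typewriter (K : ℕ) [NeZero K] (ε : ℝ) (x y : Fin K) : ℝ :=
  (if y = x then 1 - ε else 0) + (if y = x + 1 then ε else 0)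

/-- The confusability graph of a channel: two distinct inputs are adjacent iff some output is
possible for both. -/
def confusabilityGraph {K : ℕ} (W : Fin K → Fin K → ℝ) : SimpleGraph (Fin K) where
  Adj x x' := x ≠ x' ∧ ∃ y, 0 < W x y ∧ 0 < W x' y
  symm := ⟨fun _ _ h => ⟨h.1.symm, h.2.imp fun _ hy => ⟨hy.2, hy.1⟩⟩⟩
  loopless := ⟨fun _ h => h.1 rfl⟩

/-- The `n`-fold strong power of a graph. -/
def strongPower {V : Type*} (G : SimpleGraph V) (n : ℕ) : SimpleGraph (Fin n → V) where
  Adj x x' := x ≠ x' ∧ ∀ i, x i = x' i ∨ G.Adj (x i) (x' i)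
  symm := ⟨fun _ _ h => ⟨h.1.symm, fun i => (h.2 i).imp Eq.symm fun a => a.symm⟩⟩
  loopless := ⟨fun _ h => h.1 rfl⟩

/-- The admissible plans of a phase when every nonempty active set is admissible.  In phase `r`
the plan "pull each arm of `S` exactly `m_r` times" is determined by `S`, because the repetition
budget `m_r` is agreed upon beforehand. -/
abbrev Plan (K : ℕ) : Type := {S : Finset (Fin K) // S.Nonempty}

/-- A block code conveying a plan in `length` channel uses.  The first argument of the encoder and
of the decoder is the (publicly known) number of rounds that precede the packet, so that a code may
follow a public schedule. -/
structure PacketCode (K : ℕ) where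
  length : ℕ
  enc : ℕ → Plan K → Fin length → Fin K
  dec : ℕ → (Fin length → Fin K) → Plan K

/-- Every output block that is possible for the transmitted codeword is decoded correctly. -/
def PacketCode.ZeroError {K : ℕ} (c : PacketCode K) (W : Fin K → Fin K → ℝ) : Prop :=
  ∀ (s : ℕ) (p : Plan K) (y : Fin c.length → Fin K),
    (∀ i, 0 < W (c.enc s p i) (y i)) → c.dec s y = p

/-! ### Base-`b` digits of plan indices -/

/-- The `j`-th base-`b` digit of the index of the plan `p` in the enumeration `e`. -/
def digit {K : ℕ} (e : Plan K ≃ Fin (Fintype.card (Plan K))) (b : ℕ) (p : Plan K) (j : ℕ) : ℕ :=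
  (e p).val / b ^ j % b

/-- The plan whose index has the base-`b` digits `d` (least significant first); for numbers that
are not the index of a plan, the full set is returned. -/
def planOfDigits {K : ℕ} [NeZero K] (e : Plan K ≃ Fin (Fintype.card (Plan K))) (b : ℕ) {L : ℕ}
    (d : Fin L → ℕ) : Plan K :=
  if h : ∑ j, d j * b ^ j.val < Fintype.card (Plan K) then e.symm ⟨_, h⟩
  else ⟨Finset.univ, Finset.univ_nonempty⟩

/-- The length-2 slope codeword `φ(d) = (d, 2d mod 5)` of a base-5 digit; `false` selects the first
coordinate, `true` the second. -/
def slope (d : Fin 5) (second : Bool) : Fin 5 := if second then 2 * d else d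

/-- Decoder of the slope code.  If `y₁ = d + e₁` and `y₂ = 2d + e₂` with `e₁, e₂ ∈ {0, 1}`, then
`2 y₁ - y₂ = 2 e₁ - e₂`, which is `1` or `2` exactly if `e₁ = 1`. -/
def slopeDec (y₁ y₂ : Fin 5) : Fin 5 :=
  if 2 * y₁ - y₂ = 1 ∨ 2 * y₁ - y₂ = 2 then y₁ - 1 else y₁

/-- The plan packet on `C₅`: the `⌈log₅ |𝒫|⌉` base-5 digits of the plan index are sent one after
the other, each with the length-2 slope code. -/
def slopePacket (e : Plan 5 ≃ Fin (Fintype.card (Plan 5))) : PacketCode 5 where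
  length := 2 * ⌈Real.logb 5 (Fintype.card (Plan 5))⌉₊
  enc _ p i := slope (Fin.ofNat 5 (digit e 5 p (i.val / 2))) (i.val % 2 = 1)
  dec _ y := planOfDigits e 5 fun j : Fin ⌈Real.logb 5 (Fintype.card (Plan 5))⌉₊ =>
    (slopeDec (y ⟨2 * j.val, by omega⟩) (y ⟨2 * j.val + 1, by omega⟩)).val

/-- The public parity schedule on `C₆`: the active set is `{0, 2, 4}` or `{1, 3, 5}`, according to
whether the number `t` of preceding rounds is even or odd. -/
def calendar (t : ℕ) : Finset (Fin 6) := Finset.univ.filter fun x => x.val % 2 = t % 2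

/-- The element number `d ∈ {0, 1, 2}` of the set that is active in slot `t`. -/
def calendarEnc (t : ℕ) (d : ℕ) : Fin 6 := Fin.ofNat 6 (2 * (d % 3) + t % 2)

/-- The ternary digit received in slot `t`: the input is recovered from the output `y` as `y` or
`y - 1`, whichever is in the active set. -/
def calendarDec (t : ℕ) (y : Fin 6) : ℕ := (if y ∈ calendar t then y else y - 1).val / 2

/-- The plan packet on `C₆`: the `⌈log₃ |𝒫|⌉` ternary digits of the plan index are sent one after
the other, one per slot, under the public parity schedule. -/
def calendarPacket (e : Plan 6 ≃ Fin (Fintype.card (Plan 6))) : PacketCode 6 where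
  length := ⌈Real.logb 3 (Fintype.card (Plan 6))⌉₊
  enc s p i := calendarEnc (s + i.val) (digit e 3 p i.val)
  dec s y := planOfDigits e 3 fun j => calendarDec (s + j.val) (y j)

/-! ### Phased successive elimination -/

/-- The confidence radius `β(t) = √(2 log(8 K t² / δ) / t)`. -/
def radius (K : ℕ) (δ : ℝ) (t : ℕ) : ℝ :=
  Real.sqrt (2 * Real.log (8 * K * (t : ℝ) ^ 2 / δ) / t)

/-- The elimination step with `t` counted samples per arm of `S` and empirical means `m`:
the arm `a` survives iff `UCB_a ≥ LCB_b` for every `b ∈ S`, that is, iff `UCB_a` is at least the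
largest lower confidence bound. -/
def eliminate {K : ℕ} (δ : ℝ) (t : ℕ) (m : Fin K → ℝ) (S : Finset (Fin K)) : Finset (Fin K) :=
  open scoped Classical in
  S.filter fun a => ∀ b ∈ S, m b - radius K δ t ≤ m a + radius K δ t

/-- Active sets of the clean (undisturbed) phased successive elimination, where `m t a` is the
empirical mean of the first `t` rewards of arm `a`: `cleanActive δ m r` is the active set after `r`
phases.  Phase `r + 1` has the budget `2 ^ r` per active arm, so that each surviving arm has
`2 ^ (r + 1) - 1` samples at its end; nothing changes once one arm is left. -/
def cleanActive {K : ℕ} (δ : ℝ) (m : ℕ → Fin K → ℝ) : ℕ → Finset (Fin K)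
  | 0 => Finset.univ
  | r + 1 =>
    if 1 < (cleanActive δ m r).card then
      eliminate δ (2 ^ (r + 1) - 1) (m (2 ^ (r + 1) - 1)) (cleanActive δ m r)
    else cleanActive δ m r

/-- The total number of pulls of clean phased successive elimination (`⊤` if it does not stop). -/
def cleanPulls {K : ℕ} (δ : ℝ) (m : ℕ → Fin K → ℝ) : ℕ∞ :=
  ⨆ n : ℕ, ((∑ r ∈ Finset.range n,
    if 1 < (cleanActive δ m r).card then (cleanActive δ m r).card * 2 ^ r else 0 : ℕ) : ℕ∞)

/-- The pull complexity `N_SE(δ, μ)` of clean phased successive elimination: the largest number of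
pulls that it makes on the concentration event
`|μ̂_a(t) - μ_a| ≤ β(t)` for all arms `a` and all `t ≥ 1`. -/
def pullComplexity {K : ℕ} (δ : ℝ) (μ : Fin K → ℝ) : ℕ∞ :=
  ⨆ (m : ℕ → Fin K → ℝ) (_ : ∀ a, ∀ t, 1 ≤ t → |m t a - μ a| ≤ radius K δ t), cleanPulls δ m

/-- The instance-dependent rate `∑_{a ≠ a⋆} Δ_a⁻² log(K log(1/Δ_a)/δ)` with its hidden logarithmic
factor `log(e + 1/Δ_a)` written out; `1 + Δ_a⁻²` and `e + 1/Δ_a` stand for `Δ_a⁻²` and `1/Δ_a` so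
that the expression is also meaningful for gaps `Δ_a` that are not small. -/
def gapRate {K : ℕ} (δ : ℝ) (μ : Fin K → ℝ) (best : Fin K) : ℝ :=
  ∑ a ∈ Finset.univ.erase best,
    (1 + 1 / (μ best - μ a) ^ 2) * Real.log (Real.exp 1 + 1 / (μ best - μ a)) *
      Real.log (K * Real.log (Real.exp 1 + 1 / (μ best - μ a)) / δ)

/-! ### Packetized successive elimination over an actuation channel -/

/-- In the execution segment with budget `m`, the plan `D` pulls its arms in increasing order, each
for `m` rounds; `planArm D m j` is the arm pulled in round `j = 0, 1, …` of the segment. -/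
def planArm {K : ℕ} (D : Plan K) (m j : ℕ) : Fin K :=
  (D.1.sort (· ≤ ·)).getD (j / m) (D.1.max' D.2)

/-- The state of the system between two phases: the number of phases executed so far, the number of
physical rounds elapsed, the learner's active set and its totals of counted rewards, and the arm
that the agent holds. -/
structure State (K : ℕ) where
  phases : ℕ
  rounds : ℕ
  active : Finset (Fin K)
  total : Fin K → ℝ
  hold : Fin K

/-- One phase.  `y t x` is the channel output in round `t` if the input is `x`, and `x t a` is the
reward in round `t` if the agent pulls arm `a`.  With `n` the packet length, in the first `n` rounds
of the phase the learner transmits the packet for its active set while the agent pulls the held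
arm; then the agent executes the plan `D` that it has decoded (channel outputs are ignored
meanwhile).  The learner sees only the rewards; it counts those of the execution segment,
attributing them according to the plan it has sent.  Once one arm is left, nothing changes. -/
def phaseStep {K : ℕ} (δ : ℝ) (code : ℕ → PacketCode K) (y : ℕ → Fin K → Fin K)
    (x : ℕ → Fin K → ℝ) (st : State K) : State K :=
  if h : 1 < st.active.card then
    let c := code (st.phases + 1)
    let n := c.length
    let m := 2 ^ st.phases
    let t := 2 ^ (st.phases + 1) - 1
    let S : Plan K := ⟨st.active, Finset.card_pos.mp (by omega)⟩
    let D : Plan K := c.dec st.rounds fun i => y (st.rounds + i.val) (c.enc st.rounds S i)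
    let arm : ℕ → Fin K := fun i => if i < n then st.hold else planArm D m (i - n)
    let reward : ℕ → ℝ := fun i => x (st.rounds + i) (arm i)
    let total : Fin K → ℝ := fun a => st.total a +
      ∑ j ∈ Finset.range (st.active.card * m), if planArm S m j = a then reward (n + j) else 0
    { phases := st.phases + 1
      rounds := st.rounds + n + st.active.card * m
      active := eliminate δ t (fun a => total a / t) st.active
      total := total
      hold := arm (n + st.active.card * m - 1) }
  else st

/-- The state after (at most) `r` phases, starting with all arms active and the agent holding
`h₀`. -/
def run {K : ℕ} (δ : ℝ) (code : ℕ → PacketCode K) (h₀ : Fin K) (y : ℕ → Fin K → Fin K)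
    (x : ℕ → Fin K → ℝ) : ℕ → State K
  | 0 => { phases := 0, rounds := 0, active := Finset.univ, total := 0, hold := h₀ }
  | r + 1 => phaseStep δ code y x (run δ code h₀ y x r)

/-- The total number `τ` of physical rounds (`⊤` if the algorithm does not stop). -/
def stoppingTime {K : ℕ} (δ : ℝ) (code : ℕ → PacketCode K) (h₀ : Fin K) (y : ℕ → Fin K → Fin K)
    (x : ℕ → Fin K → ℝ) : ℕ∞ := ⨆ r : ℕ, ((run δ code h₀ y x r).rounds : ℕ∞)

/-- The number `R` of executed phases (`⊤` if the algorithm does not stop). -/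
def numPhases {K : ℕ} (δ : ℝ) (code : ℕ → PacketCode K) (h₀ : Fin K) (y : ℕ → Fin K → Fin K)
    (x : ℕ → Fin K → ℝ) : ℕ∞ := ⨆ r : ℕ, ((run δ code h₀ y x r).phases : ℕ∞)

/-- The algorithm stops and returns the arm `a`. -/
def Returns {K : ℕ} (δ : ℝ) (code : ℕ → PacketCode K) (h₀ : Fin K) (y : ℕ → Fin K → Fin K)
    (x : ℕ → Fin K → ℝ) (a : Fin K) : Prop := ∃ r : ℕ, (run δ code h₀ y x r).active = {a}

/-! ### Probabilistic model -/

/-- The mean of arm `a` with reward law `ν a`. -/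
def mean {K : ℕ} (ν : Fin K → Measure ℝ) (a : Fin K) : ℝ := ∫ r, r ∂(ν a)

/-- Every reward law is a probability measure and `1`-subGaussian about its mean. -/
def IsOneSubGaussian {K : ℕ} (ν : Fin K → Measure ℝ) : Prop :=
  ∀ a, IsProbabilityMeasure (ν a) ∧ HasSubgaussianMGF (fun r => r - mean ν a) 1 (ν a)

/-- `best` is the unique arm of largest mean. -/
def IsUniqueBest {K : ℕ} (μ : Fin K → ℝ) (best : Fin K) : Prop := ∀ a, a ≠ best → μ a < μ best

/-- The clean bandit: `X j a` is the reward of pull number `j + 1` of arm `a`; all rewards are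
independent and those of arm `a` have law `ν a`. -/
structure IsCleanBandit {K : ℕ} (ν : Fin K → Measure ℝ) {Ω : Type*} [MeasurableSpace Ω]
    (P : Measure Ω) (X : ℕ → Fin K → Ω → ℝ) : Prop where
  measurable : ∀ j a, Measurable (X j a)
  law : ∀ j a, P.map (X j a) = ν a
  indep : iIndepFun (fun p : ℕ × Fin K => X p.1 p.2) P

/-- The bandit behind a memoryless actuation channel `W`.  In round `t`, the input `x` is received
as `Y t x`, which has law `W(· | x)`, and pulling arm `a` pays `X t a`, which has law `ν a`.
The rounds are independent, and in each round the channel is independent of the rewards. -/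
structure IsActuatedBandit {K : ℕ} (W : Fin K → Fin K → ℝ) (ν : Fin K → Measure ℝ) {Ω : Type*}
    [MeasurableSpace Ω] (P : Measure Ω) (Y : ℕ → Fin K → Ω → Fin K) (X : ℕ → Fin K → Ω → ℝ) :
    Prop where
  measurable_output : ∀ t x, Measurable (Y t x)
  measurable_reward : ∀ t a, Measurable (X t a)
  law_output : ∀ t x y, P {ω | Y t x ω = y} = ENNReal.ofReal (W x y)
  law_reward : ∀ t a, P.map (X t a) = ν a
  indep_rounds :
    iIndepFun (fun (t : ℕ) (ω : Ω) => ((fun x => Y t x ω), (fun a => X t a ω))) P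
  indep_output_reward :
    ∀ t, IndepFun (fun (ω : Ω) (x : Fin K) => Y t x ω) (fun (ω : Ω) (a : Fin K) => X t a ω) P

end PSE

end

noncomputable section

namespace PSE

/-! ### Successive elimination on the concentration event -/

/-! The argument separates into a deterministic analysis of elimination, the removal of the channel,
and a concentration bound for the rewards that are counted.

Rate. On the concentration event the best arm is never eliminated, and any other arm that is still
competing after `t` samples has gap at most `4 β(t)`. Inverting this inequality bounds `t + 1` by a
multiple of `gapTerm` (`sample_count_le`). Budgets double, so all pulls of an arm cost at most twice
its last budget, and the pulls of the best arm are charged to its competitors (`sum_pulls_le`). The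
same bound forces termination.

Channel. Almost surely only outputs of positive probability occur, so zero-error packets are always
decoded correctly and the run coincides with the run over a noiseless channel (`run_eq_cleanRun`).
Zero error is a finite check for the slope code; for the calendar it holds because `x` and `x + 1`
have opposite parity on an even cycle.

Concentration. The physical rounds in which an arm is sampled depend on earlier rewards, so a tail
bound for a fixed set of rounds does not apply. Once the number of elapsed rounds and the active set
are fixed, however, the sampling rounds of the next phase are fixed and lie in the future.
Independence then multiplies the exponential moment of the total by the factor for `2 ^ r` fresh
samples (`lintegral_exp_total_succ_le`). Iterating over phases, Chernoff's inequality and a union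
bound conclude.

Coupling. `pullComplexity` is a supremum over deterministic arrays of means. It therefore suffices
to extend the counted means to one concentrated array (`coupledMeans`) on which clean elimination
makes the same decisions. The rounds of the run are then clean pulls plus packets. -/

/-- The event on which the pull complexity is defined. -/
def Concentrated {K : ℕ} (δ : ℝ) (μ : Fin K → ℝ) (m : ℕ → Fin K → ℝ) : Prop :=
  ∀ a, ∀ t, 1 ≤ t → |m t a - μ a| ≤ radius K δ t

lemma radius_nonneg (K : ℕ) (δ : ℝ) (t : ℕ) : 0 ≤ radius K δ t := Real.sqrt_nonneg _

lemma mem_eliminate {K : ℕ} {δ : ℝ} {t : ℕ} {m : Fin K → ℝ} {S : Finset (Fin K)} {a : Fin K} :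
    a ∈ eliminate δ t m S ↔
      a ∈ S ∧ ∀ b ∈ S, m b - radius K δ t ≤ m a + radius K δ t := by
  simp [eliminate]

lemma eliminate_congr {K : ℕ} {δ : ℝ} {t : ℕ} {m m' : Fin K → ℝ} {S : Finset (Fin K)}
    (h : ∀ a ∈ S, m a = m' a) : eliminate δ t m S = eliminate δ t m' S := by
  ext a
  simp only [mem_eliminate]
  refine and_congr_right fun ha => forall₂_congr fun b hb => ?_
  rw [h a ha, h b hb]

lemma cleanActive_succ_of_lt {K : ℕ} {δ : ℝ} {m : ℕ → Fin K → ℝ} {r : ℕ}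
    (h : 1 < (cleanActive δ m r).card) :
    cleanActive δ m (r + 1) =
      eliminate δ (2 ^ (r + 1) - 1) (m (2 ^ (r + 1) - 1)) (cleanActive δ m r) := by
  rw [cleanActive, if_pos h]

lemma cleanActive_succ_of_not_lt {K : ℕ} {δ : ℝ} {m : ℕ → Fin K → ℝ} {r : ℕ}
    (h : ¬ 1 < (cleanActive δ m r).card) : cleanActive δ m (r + 1) = cleanActive δ m r := by
  rw [cleanActive, if_neg h]

lemma one_le_two_pow_succ_sub_one (r : ℕ) : 1 ≤ 2 ^ (r + 1) - 1 := by
  have := Nat.one_le_two_pow (n := r)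
  rw [pow_succ]
  omega

lemma best_mem_cleanActive {K : ℕ} {δ : ℝ} {μ : Fin K → ℝ} {best : Fin K}
    (hbest : IsUniqueBest μ best) {m : ℕ → Fin K → ℝ} (hm : Concentrated δ μ m) (r : ℕ) :
    best ∈ cleanActive δ m r := by
  induction r with
  | zero => simp [cleanActive]
  | succ r ih =>
    by_cases h : 1 < (cleanActive δ m r).card
    · rw [cleanActive_succ_of_lt h, mem_eliminate]
      refine ⟨ih, fun b _ => ?_⟩
      have h1 := abs_le.1 (hm b _ (one_le_two_pow_succ_sub_one r))
      have h2 := abs_le.1 (hm best _ (one_le_two_pow_succ_sub_one r))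
      have h3 : μ b ≤ μ best := by
        by_cases hb : b = best
        · rw [hb]
        · exact (hbest b hb).le
      linarith [h1.1, h1.2, h2.1, h2.2]
    · rwa [cleanActive_succ_of_not_lt h]

/-- Not being eliminated by the best arm allows a lag of `2β` between the empirical means, and each
of these is off by at most `β`. -/
lemma gap_le_of_mem_cleanActive {K : ℕ} {δ : ℝ} {μ : Fin K → ℝ} {best : Fin K}
    (hbest : IsUniqueBest μ best) {m : ℕ → Fin K → ℝ} (hm : Concentrated δ μ m) {r : ℕ}
    {a : Fin K} (ha : a ∈ cleanActive δ m (r + 1)) (hc : 1 < (cleanActive δ m (r + 1)).card) :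
    μ best - μ a ≤ 4 * radius K δ (2 ^ (r + 1) - 1) := by
  by_cases h : 1 < (cleanActive δ m r).card
  · rw [cleanActive_succ_of_lt h, mem_eliminate] at ha
    have h0 := ha.2 best (best_mem_cleanActive hbest hm r)
    have h1 := abs_le.1 (hm a _ (one_le_two_pow_succ_sub_one r))
    have h2 := abs_le.1 (hm best _ (one_le_two_pow_succ_sub_one r))
    linarith [h1.1, h1.2, h2.1, h2.2]
  · rw [cleanActive_succ_of_not_lt h] at hc
    exact absurd hc h

/-! ### The rate -/

/-- The contribution of an arm with gap `Δ` to `gapRate`. -/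
def gapTerm (K : ℕ) (δ Δ : ℝ) : ℝ :=
  (1 + 1 / Δ ^ 2) * Real.log (Real.exp 1 + 1 / Δ) *
    Real.log (K * Real.log (Real.exp 1 + 1 / Δ) / δ)

lemma one_le_log_exp_add {Δ : ℝ} (hΔ : 0 < Δ) : 1 ≤ Real.log (Real.exp 1 + 1 / Δ) := by
  have h : (0 : ℝ) < 1 / Δ := by positivity
  rw [Real.le_log_iff_exp_le (by positivity)]
  linarith

lemma log_two_le_log_div {K : ℕ} (hK : 2 ≤ K) {δ L : ℝ} (hδ : 0 < δ) (hδ1 : δ < 1)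
    (hL : 1 ≤ L) : Real.log 2 ≤ Real.log (K * L / δ) ∧ Real.log (K / δ) ≤ Real.log (K * L / δ) := by
  have hK' : (2 : ℝ) ≤ K := by exact_mod_cast hK
  have h2 : (2 : ℝ) ≤ K * L := by nlinarith
  refine ⟨Real.log_le_log (by norm_num) ?_, Real.log_le_log (by positivity) ?_⟩
  · rw [le_div_iff₀ hδ]; nlinarith
  · gcongr; nlinarith

lemma one_le_two_mul_log_mul_log {K : ℕ} (hK : 2 ≤ K) {δ Δ : ℝ} (hδ : 0 < δ) (hδ1 : δ < 1)
    (hΔ : 0 < Δ) :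
    1 ≤ 2 * (Real.log (Real.exp 1 + 1 / Δ) *
      Real.log (K * Real.log (Real.exp 1 + 1 / Δ) / δ)) := by
  have hL := one_le_log_exp_add hΔ
  have hM := (log_two_le_log_div hK hδ hδ1 hL).1
  have := Real.log_two_gt_d9
  nlinarith

/-- Inverts `Δ ≤ 4 β(t)`. The number `t` also occurs inside the logarithm of `β(t)`; the tangent
bound `log u ≤ u - 1` at a suitable scale absorbs it into the left side. -/
lemma sample_count_le {K : ℕ} (hK : 2 ≤ K) {δ Δ : ℝ} (hδ : 0 < δ) (hδ1 : δ < 1) (hΔ : 0 < Δ)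
    {t : ℕ} (ht : 1 ≤ t) (h : Δ ≤ 4 * radius K δ t) :
    (t : ℝ) + 1 ≤ 1664 * gapTerm K δ Δ := by
  have hK0 : (0 : ℝ) < K := by exact_mod_cast (by omega : 0 < K)
  have ht0 : (1 : ℝ) ≤ t := by exact_mod_cast ht
  have ht1 : (0 : ℝ) < t := by linarith
  have hL := one_le_log_exp_add hΔ
  obtain ⟨hM2, hMK⟩ := log_two_le_log_div hK hδ hδ1 hL
  have hLM := one_le_two_mul_log_mul_log hK hδ hδ1 hΔ
  have hLΔ : Real.log (1 / Δ) ≤ Real.log (Real.exp 1 + 1 / Δ) :=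
    Real.log_le_log (by positivity) (by linarith [Real.exp_pos 1])
  unfold gapTerm
  set L := Real.log (Real.exp 1 + 1 / Δ)
  set M := Real.log (K * L / δ)
  have hlog2 := Real.log_two_gt_d9
  have hΔ2 : Δ ^ 2 ≤ 16 * (2 * Real.log (8 * K * (t : ℝ) ^ 2 / δ) / t) := by
    -- If the radicand were negative, `Real.sqrt` would return `0`, contradicting `0 < Δ`.
    have hpos : 0 ≤ 2 * Real.log (8 * K * (t : ℝ) ^ 2 / δ) / t := by
      by_contra hneg
      rw [radius, Real.sqrt_eq_zero_of_nonpos (not_le.1 hneg).le] at h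
      linarith
    calc Δ ^ 2 ≤ (4 * radius K δ t) ^ 2 := by gcongr
      _ = _ := by rw [mul_pow, radius, Real.sq_sqrt hpos]; ring
  have hexp : Real.log (8 * K * (t : ℝ) ^ 2 / δ) =
      3 * Real.log 2 + Real.log (K / δ) + 2 * Real.log t := by
    rw [show 8 * K * (t : ℝ) ^ 2 / δ = 2 ^ 3 * (K / δ) * (t : ℝ) ^ 2 by ring,
      Real.log_mul (by positivity) (by positivity), Real.log_mul (by positivity) (by positivity),
      Real.log_pow, Real.log_pow]
    norm_num
  -- The scale 128 is chosen so that `32 * 2 * log t` contributes exactly half of `t * Δ ^ 2`.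
  have htlog : Real.log t ≤ t * Δ ^ 2 / 128 - 1 + 7 * Real.log 2 + 2 * Real.log (1 / Δ) := by
    have h1 : Real.log (t * Δ ^ 2 / 128) ≤ t * Δ ^ 2 / 128 - 1 :=
      Real.log_le_sub_one_of_pos (by positivity)
    have h2 : Real.log t =
        Real.log (t * Δ ^ 2 / 128) + 7 * Real.log 2 + 2 * Real.log (1 / Δ) := by
      have e : (t : ℝ) = t * Δ ^ 2 / 128 * 2 ^ 7 * (1 / Δ) ^ 2 := by field_simp; norm_num
      conv_lhs => rw [e]
      rw [Real.log_mul (by positivity) (by positivity), Real.log_mul (by positivity) (by positivity),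
        Real.log_pow, Real.log_pow]
      norm_num
    linarith
  -- After absorption, `t * Δ ^ 2 ≤ 64 * (17 * log 2 + log (K / δ) + 4 * log (1 / Δ))`. With `log 2
  -- ≤ M`, `M ≤ L * M` and `L ≤ 2 * (L * M)` the bracket is at most `(18 + 8) * (L * M)`, and `64 *
  -- 26 = 1664`.
  have htΔ : t * Δ ^ 2 ≤ 1664 * (L * M) := by
    have h1 : t * Δ ^ 2 ≤ 32 * Real.log (8 * K * (t : ℝ) ^ 2 / δ) := by
      calc t * Δ ^ 2 ≤ t * (16 * (2 * Real.log (8 * K * (t : ℝ) ^ 2 / δ) / t)) := by gcongr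
        _ = _ := by field_simp; ring
    have h3 : M ≤ L * M := by nlinarith
    have h4 : L ≤ 2 * (L * M) := by nlinarith
    nlinarith
  have hdiv : (t : ℝ) ≤ 1664 * (L * M) / Δ ^ 2 := by
    rw [le_div_iff₀ (by positivity)]
    exact htΔ
  calc (t : ℝ) + 1 ≤ 1664 * (L * M) / Δ ^ 2 + 1664 * (L * M) := by linarith
    _ = _ := by ring

lemma two_pow_le_gapTerm {K : ℕ} (hK : 2 ≤ K) {δ : ℝ} (hδ : 0 < δ) (hδ1 : δ < 1)
    {μ : Fin K → ℝ} {best : Fin K} (hbest : IsUniqueBest μ best) {m : ℕ → Fin K → ℝ}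
    (hm : Concentrated δ μ m) {r : ℕ} {a : Fin K} (hab : a ≠ best) (ha : a ∈ cleanActive δ m r)
    (hc : 1 < (cleanActive δ m r).card) :
    (2 : ℝ) ^ r ≤ 1664 * gapTerm K δ (μ best - μ a) := by
  have hΔ : 0 < μ best - μ a := sub_pos.2 (hbest a hab)
  cases r with
  | zero =>
    -- No elimination precedes the first phase; its single pull is paid for by the summand `1` in `1
    -- + 1 / Δ ^ 2`.
    have h1 := one_le_two_mul_log_mul_log hK hδ hδ1 hΔ
    have h2 : 0 < 1 / (μ best - μ a) ^ 2 := by positivity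
    rw [gapTerm, mul_assoc (1 + _)]
    norm_num only [pow_zero]
    nlinarith
  | succ r =>
    have h := sample_count_le hK hδ hδ1 hΔ (one_le_two_pow_succ_sub_one r)
      (gap_le_of_mem_cleanActive hbest hm ha hc)
    rw [Nat.cast_sub Nat.one_le_two_pow] at h
    push_cast at h
    linarith

/-- The largest index satisfying `p` dominates: the geometric sum up to it is less than twice its
last term. -/
lemma sum_two_pow_le {p : ℕ → Prop} [DecidablePred p] {B : ℝ} (hB : 0 ≤ B)
    (h : ∀ r, p r → (2 : ℝ) ^ r ≤ B) (n : ℕ) :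
    ∑ r ∈ Finset.range n, (if p r then (2 : ℝ) ^ r else 0) ≤ 2 * B := by
  induction n with
  | zero => simpa using hB
  | succ n ih =>
    by_cases hn : p n
    · calc ∑ r ∈ Finset.range (n + 1), (if p r then (2 : ℝ) ^ r else 0)
          ≤ ∑ r ∈ Finset.range (n + 1), (2 : ℝ) ^ r := by
            gcongr with r
            split_ifs
            · exact le_rfl
            · positivity
        _ ≤ 2 * 2 ^ n := by
            rw [geom_sum_eq (by norm_num), pow_succ]
            norm_num
            linarith
        _ ≤ 2 * B := by linarith [h n hn]
    · rw [Finset.sum_range_succ, if_neg hn, add_zero]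
      exact ih

lemma gapTerm_nonneg {K : ℕ} (hK : 2 ≤ K) {δ Δ : ℝ} (hδ : 0 < δ) (hδ1 : δ < 1) (hΔ : 0 < Δ) :
    0 ≤ gapTerm K δ Δ := by
  have h := one_le_two_mul_log_mul_log hK hδ hδ1 hΔ
  rw [gapTerm, mul_assoc]
  have : 0 < 1 / Δ ^ 2 := by positivity
  nlinarith

/-- Charges the pulls of the best arm, which has no gap of its own, to the other active arms. -/
lemma card_le_two_mul_card_erase {α : Type*} [DecidableEq α] {S : Finset α} (hS : 1 < S.card)
    (a : α) : S.card ≤ 2 * (S.erase a).card := by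
  have := Finset.pred_card_le_card_erase (s := S) (a := a)
  omega

/-- The constant is `6656 = 2 * 2 * 1664`: one factor 2 for charging the best arm, one for the
geometric series. -/
lemma sum_pulls_le {K : ℕ} {δ : ℝ} (hδ : 0 < δ) (hδ1 : δ < 1)
    {μ : Fin K → ℝ} {best : Fin K} (hbest : IsUniqueBest μ best) {m : ℕ → Fin K → ℝ}
    (hm : Concentrated δ μ m) (n : ℕ) :
    ((∑ r ∈ Finset.range n, if 1 < (cleanActive δ m r).card then
      (cleanActive δ m r).card * 2 ^ r else 0 : ℕ) : ℝ) ≤ 6656 * gapRate δ μ best := by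
  classical
  by_cases hK : 2 ≤ K
  · have key : ∀ r, (((if 1 < (cleanActive δ m r).card then
        (cleanActive δ m r).card * 2 ^ r else 0 : ℕ)) : ℝ) ≤
        ∑ a ∈ Finset.univ.erase best, 2 * (if 1 < (cleanActive δ m r).card ∧
          a ∈ cleanActive δ m r then (2 : ℝ) ^ r else 0) := by
      intro r
      by_cases hc : 1 < (cleanActive δ m r).card
      · simp only [hc, if_true, true_and]
        have h1 : (((cleanActive δ m r).card : ℕ) : ℝ) ≤
            2 * (((cleanActive δ m r).erase best).card : ℕ) := by
          exact_mod_cast card_le_two_mul_card_erase hc best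
        rw [← Finset.mul_sum, ← Finset.sum_filter, Finset.sum_const, nsmul_eq_mul]
        have h2 : (Finset.univ.erase best).filter (· ∈ cleanActive δ m r) =
            (cleanActive δ m r).erase best := by
          ext a; simp
        rw [h2]
        push_cast
        have : (0 : ℝ) < 2 ^ r := by positivity
        nlinarith
      · simp [hc]
    push_cast at key ⊢
    calc _ ≤ ∑ r ∈ Finset.range n, ∑ a ∈ Finset.univ.erase best,
          2 * (if 1 < (cleanActive δ m r).card ∧ a ∈ cleanActive δ m r then (2 : ℝ) ^ r else 0) :=
          Finset.sum_le_sum fun r _ => key r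
      _ = ∑ a ∈ Finset.univ.erase best, 2 * ∑ r ∈ Finset.range n,
          (if 1 < (cleanActive δ m r).card ∧ a ∈ cleanActive δ m r then (2 : ℝ) ^ r else 0) := by
          rw [Finset.sum_comm]
          simp_rw [Finset.mul_sum]
      _ ≤ ∑ a ∈ Finset.univ.erase best, 6656 * gapTerm K δ (μ best - μ a) := by
          refine Finset.sum_le_sum fun a ha => ?_
          have hab := (Finset.mem_erase.1 ha).1
          have hg := gapTerm_nonneg hK hδ hδ1 (sub_pos.2 (hbest a hab))
          have := sum_two_pow_le
            (p := fun r => 1 < (cleanActive δ m r).card ∧ a ∈ cleanActive δ m r)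
            (B := 1664 * gapTerm K δ (μ best - μ a)) (by positivity)
            (fun r hr => two_pow_le_gapTerm hK hδ hδ1 hbest hm hab hr.2 hr.1) n
          linarith
      _ = 6656 * gapRate δ μ best := by rw [gapRate, Finset.mul_sum]; rfl
  -- With a single arm nothing is ever pulled and the rate is an empty sum.
  · have hcard : ∀ r, ¬ 1 < (cleanActive δ m r).card := fun r h => by
      have := (cleanActive δ m r).card_le_univ
      rw [Fintype.card_fin] at this
      omega
    have he : (Finset.univ.erase best : Finset (Fin K)) = ∅ := by
      ext a
      have := a.2
      have := best.2
      simp only [Finset.mem_erase, Finset.mem_univ, and_true, Finset.notMem_empty, iff_false,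
        not_not]
      ext
      omega
    simp [hcard, gapRate, he]

lemma pullComplexity_le {K : ℕ} {δ : ℝ} (hδ : 0 < δ) (hδ1 : δ < 1)
    {μ : Fin K → ℝ} {best : Fin K} (hbest : IsUniqueBest μ best) :
    ((pullComplexity δ μ : ℕ∞) : ℝ≥0∞) ≤ ENNReal.ofReal (6656 * gapRate δ μ best) := by
  -- Pull counts are integers, so the real bound passes through its floor before the supremum in
  -- `ℕ∞` is taken.
  have h : pullComplexity δ μ ≤ ((⌊6656 * gapRate δ μ best⌋₊ : ℕ) : ℕ∞) := by
    refine iSup₂_le fun m hm => iSup_le fun n => ?_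
    exact_mod_cast Nat.le_floor (sum_pulls_le hδ hδ1 hbest hm n)
  have h0 : 0 ≤ 6656 * gapRate δ μ best := by
    by_cases hne : ∃ m : ℕ → Fin K → ℝ, Concentrated δ μ m
    · obtain ⟨m, hm⟩ := hne
      simpa using sum_pulls_le hδ hδ1 hbest hm 0
    · exact absurd ⟨fun _ => μ, fun a t _ => by simpa using radius_nonneg K δ t⟩ hne
  calc ((pullComplexity δ μ : ℕ∞) : ℝ≥0∞)
      ≤ (((⌊6656 * gapRate δ μ best⌋₊ : ℕ) : ℕ∞) : ℝ≥0∞) := by exact_mod_cast h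
    _ = ENNReal.ofReal (⌊6656 * gapRate δ μ best⌋₊ : ℝ) := by simp
    _ ≤ _ := ENNReal.ofReal_le_ofReal (Nat.floor_le h0)

lemma cleanPulls_le_pullComplexity {K : ℕ} {δ : ℝ} {μ : Fin K → ℝ} {m : ℕ → Fin K → ℝ}
    (hm : Concentrated δ μ m) : cleanPulls δ m ≤ pullComplexity δ μ :=
  le_iSup₂ (f := fun (m : ℕ → Fin K → ℝ)
    (_ : ∀ a, ∀ t, 1 ≤ t → |m t a - μ a| ≤ radius K δ t) => cleanPulls δ m) m hm

/-- On the concentration event, elimination stops with the best arm. -/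
lemma exists_cleanActive_eq_singleton {K : ℕ} {δ : ℝ} (hδ : 0 < δ) (hδ1 : δ < 1)
    {μ : Fin K → ℝ} {best : Fin K} (hbest : IsUniqueBest μ best) {m : ℕ → Fin K → ℝ}
    (hm : Concentrated δ μ m) : ∃ r, cleanActive δ m r = {best} := by
  -- If elimination never stopped, every phase would make at least one pull, and this many phases
  -- would exceed the bound on the pulls.
  obtain ⟨n, hn⟩ := exists_nat_gt (6656 * gapRate δ μ best)
  by_contra! hne
  have hc : ∀ r, 1 < (cleanActive δ m r).card := fun r => by
    refine Finset.one_lt_card_iff_nontrivial.2 ?_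
    refine (Finset.nontrivial_iff_ne_singleton (best_mem_cleanActive hbest hm r)).2 (hne r)
  have h := sum_pulls_le hδ hδ1 hbest hm n
  have h2 : (n : ℝ) ≤ ((∑ r ∈ Finset.range n, if 1 < (cleanActive δ m r).card then
      (cleanActive δ m r).card * 2 ^ r else 0 : ℕ) : ℝ) := by
    norm_cast
    calc n = ∑ r ∈ Finset.range n, 1 := by simp
      _ ≤ _ := Finset.sum_le_sum fun r _ => by
        rw [if_pos (hc r)]
        exact Nat.succ_le_of_lt (Nat.mul_pos (by have := hc r; omega) (by positivity))
  linarith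

/-! ### Union bound over the confidence intervals -/

/-- The radius is designed for this: the one-sided subGaussian tail at level `β(t)` is summable in
`t` and carries the factor `1 / K` for the union over arms. -/
lemma exp_neg_mul_radius_sq {K : ℕ} (hK : 1 ≤ K) {δ : ℝ} (hδ : 0 < δ) (hδ1 : δ < 1) {t : ℕ}
    (ht : 1 ≤ t) :
    Real.exp (-(t * radius K δ t ^ 2 / 2)) = δ / (8 * K * (t : ℝ) ^ 2) := by
  have hK' : (1 : ℝ) ≤ K := by exact_mod_cast hK
  have ht' : (1 : ℝ) ≤ t := by exact_mod_cast ht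
  have ht2 : (1 : ℝ) ≤ (t : ℝ) ^ 2 := one_le_pow₀ ht'
  have h1 : 1 ≤ 8 * K * (t : ℝ) ^ 2 / δ := by
    rw [le_div_iff₀ hδ]
    nlinarith [mul_le_mul hK' ht2 zero_le_one (by linarith)]
  rw [radius, Real.sq_sqrt (div_nonneg (mul_nonneg zero_le_two (Real.log_nonneg h1))
    (by positivity))]
  have h2 : (t : ℝ) * (2 * Real.log (8 * K * (t : ℝ) ^ 2 / δ) / t) / 2 =
      Real.log (8 * K * (t : ℝ) ^ 2 / δ) := by
    field_simp
  rw [h2, Real.exp_neg, Real.exp_log (by positivity), inv_div]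

/-- Since `ζ(2) ≤ 4`, the bad events of each arm have total mass at most `δ / K`. The same summable
tail serves sample counts `r + 1` in the clean bandit and phases `r + 1` in the packetized run. -/
lemma ofReal_one_sub_le_measure_of_tail {K : ℕ} (hK : 1 ≤ K) {δ : ℝ} (hδ : 0 < δ)
    {Ω : Type*} [MeasurableSpace Ω] (P : Measure Ω) [IsProbabilityMeasure P]
    (bad : Fin K → ℕ → Set Ω)
    (h : ∀ a r, P (bad a r) ≤ ENNReal.ofReal (δ / (4 * K * ((r + 1 : ℕ) : ℝ) ^ 2))) :
    ENNReal.ofReal (1 - δ) ≤ P {ω | ∀ a r, ω ∉ bad a r} := by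
  have hK' : (0 : ℝ) < K := by exact_mod_cast hK
  have hzeta : HasSum (fun r : ℕ => δ / (4 * K * ((r + 1 : ℕ) : ℝ) ^ 2))
      (δ / (4 * K) * (Real.pi ^ 2 / 6)) := by
    have h1 := ((hasSum_nat_add_iff' 1).2 hasSum_zeta_two).mul_left (δ / (4 * K))
    simp only [Finset.range_one, Finset.sum_singleton, Nat.cast_zero, ne_eq, OfNat.ofNat_ne_zero,
      not_false_eq_true, zero_pow, div_zero, sub_zero] at h1
    refine h1.congr_fun fun r => ?_
    field_simp
  have hpi : Real.pi ^ 2 / 6 ≤ 4 := by nlinarith [Real.pi_le_four, Real.pi_pos]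
  have htsum : ∀ a, P (⋃ r, bad a r) ≤ ENNReal.ofReal (δ / K) := fun a => by
    calc P (⋃ r, bad a r) ≤ ∑' r, P (bad a r) := measure_iUnion_le _
      _ ≤ ∑' r : ℕ, ENNReal.ofReal (δ / (4 * K * ((r + 1 : ℕ) : ℝ) ^ 2)) :=
        ENNReal.tsum_le_tsum (h a)
      _ = ENNReal.ofReal (δ / (4 * K) * (Real.pi ^ 2 / 6)) := by
        rw [← ENNReal.ofReal_tsum_of_nonneg (fun r => by positivity) hzeta.summable, hzeta.tsum_eq]
      _ ≤ ENNReal.ofReal (δ / K) := by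
        refine ENNReal.ofReal_le_ofReal ?_
        calc δ / (4 * K) * (Real.pi ^ 2 / 6) ≤ δ / (4 * K) * 4 := by gcongr
          _ = δ / K := by field_simp
  have hbad : P {ω | ∀ a r, ω ∉ bad a r}ᶜ ≤ ENNReal.ofReal δ := by
    have hset : {ω | ∀ a r, ω ∉ bad a r}ᶜ = ⋃ a, ⋃ r, bad a r := by
      ext ω; simp
    rw [hset]
    calc P (⋃ a, ⋃ r, bad a r) ≤ ∑ a, P (⋃ r, bad a r) := measure_iUnion_fintype_le _ _
      _ ≤ ∑ _a : Fin K, ENNReal.ofReal (δ / K) := Finset.sum_le_sum fun a _ => htsum a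
      _ = ENNReal.ofReal δ := by
        rw [Finset.sum_const, Finset.card_univ, Fintype.card_fin, ← ENNReal.ofReal_nsmul,
          nsmul_eq_mul]
        congr 1
        field_simp
  -- Subadditivity is enough here, so the bad events need not be measurable.
  have htot : 1 ≤ P {ω | ∀ a r, ω ∉ bad a r} + P {ω | ∀ a r, ω ∉ bad a r}ᶜ := by
    rw [← measure_univ (μ := P), ← Set.union_compl_self {ω | ∀ a r, ω ∉ bad a r}]
    exact measure_union_le _ _
  rw [ENNReal.ofReal_sub _ hδ.le, ENNReal.ofReal_one, tsub_le_iff_right]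
  exact htot.trans (by gcongr)

lemma hasSubgaussianMGF_sub_mean {K : ℕ} {ν : Fin K → Measure ℝ} (hν : IsOneSubGaussian ν)
    {Ω : Type*} [MeasurableSpace Ω] {P : Measure Ω} {a : Fin K} {Z : Ω → ℝ} (hZ : Measurable Z)
    (hlaw : P.map Z = ν a) : HasSubgaussianMGF (fun ω => Z ω - mean ν a) 1 P := by
  have h := (hν a).2
  rw [← hlaw] at h
  exact HasSubgaussianMGF.of_map hZ.aemeasurable h

lemma clean_tail_le {K : ℕ} {δ : ℝ} {ν : Fin K → Measure ℝ} {Ω : Type*}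
    [MeasurableSpace Ω] {P : Measure Ω} [IsProbabilityMeasure P] {X : ℕ → Fin K → Ω → ℝ}
    (hδ : 0 < δ) (hδ1 : δ < 1) (hν : IsOneSubGaussian ν) (hX : IsCleanBandit ν P X)
    (a : Fin K) (r : ℕ) :
    P {ω | radius K δ (r + 1) <
        |(∑ j ∈ Finset.range (r + 1), X j a ω) / (r + 1 : ℕ) - mean ν a|} ≤
      ENNReal.ofReal (δ / (4 * K * ((r + 1 : ℕ) : ℝ) ^ 2)) := by
  have hK : 1 ≤ K := by have := a.2; omega
  set t := r + 1 with ht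
  have htpos : (0 : ℝ) < t := by positivity
  set β := radius K δ t
  have hβ : 0 ≤ β := radius_nonneg _ _ _
  have hsub : ∀ j, HasSubgaussianMGF (fun ω => X j a ω - mean ν a) 1 P := fun j =>
    hasSubgaussianMGF_sub_mean hν (hX.measurable j a) (hX.law j a)
  have hind : iIndepFun (fun (j : ℕ) (ω : Ω) => X j a ω - mean ν a) P :=
    (hX.indep.precomp (g := fun j : ℕ => (j, a)) fun i j h => (Prod.mk.inj h).1).comp
      (fun _ x => x - mean ν a) fun _ => by fun_prop
  have hnind : iIndepFun (fun (j : ℕ) => -fun (ω : Ω) => X j a ω - mean ν a) P :=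
    hind.comp (fun _ x => -x) fun _ => by fun_prop
  have hexp : Real.exp (-(t * β) ^ 2 / (2 * t * (1 : NNReal))) =
      δ / (8 * K * (t : ℝ) ^ 2) := by
    rw [← exp_neg_mul_radius_sq hK hδ hδ1 (by omega : 1 ≤ t)]
    congr 1
    push_cast
    field_simp
    rfl
  have hup := HasSubgaussianMGF.measure_sum_range_ge_le_of_iIndepFun hind (c := 1) (n := t)
    (fun j _ => hsub j) (ε := t * β) (by positivity)
  have hlo := HasSubgaussianMGF.measure_sum_range_ge_le_of_iIndepFun hnind (c := 1) (n := t)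
    (fun j _ => (hsub j).neg) (ε := t * β) (by positivity)
  rw [hexp] at hup hlo
  have hsum : ∀ ω, ∑ j ∈ Finset.range t, (X j a ω - mean ν a) =
      t * ((∑ j ∈ Finset.range t, X j a ω) / t - mean ν a) := fun ω => by
    rw [Finset.sum_sub_distrib, Finset.sum_const, Finset.card_range, nsmul_eq_mul]
    field_simp
  have hcov : {ω | β < |(∑ j ∈ Finset.range t, X j a ω) / t - mean ν a|} ⊆
      {ω | t * β ≤ ∑ j ∈ Finset.range t, (X j a ω - mean ν a)} ∪
      {ω | t * β ≤ ∑ j ∈ Finset.range t, (-fun ω => X j a ω - mean ν a) ω} := by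
    intro ω hω
    simp only [Set.mem_union, Set.mem_ofPred_eq, Pi.neg_apply, Finset.sum_neg_distrib, hsum] at hω ⊢
    rcases lt_abs.1 hω with h | h
    · left; nlinarith
    · right; nlinarith
  calc _ ≤ _ := measure_mono hcov
    _ ≤ _ := measure_union_le _ _
    _ ≤ ENNReal.ofReal (δ / (8 * K * (t : ℝ) ^ 2)) + ENNReal.ofReal (δ / (8 * K * (t : ℝ) ^ 2)) := by
      gcongr
      · rw [← ofReal_measureReal]; exact ENNReal.ofReal_le_ofReal hup
      · rw [← ofReal_measureReal]; exact ENNReal.ofReal_le_ofReal hlo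
    _ = _ := by
      rw [← ENNReal.ofReal_add (by positivity) (by positivity)]
      congr 1
      have : (0 : ℝ) < K := by exact_mod_cast hK
      field_simp
      norm_num

/-- With probability at least `1 - δ`, clean successive elimination makes at most
`pullComplexity` pulls. -/
theorem clean_guarantee {K : ℕ} {δ : ℝ} {ν : Fin K → Measure ℝ} (hK : 1 ≤ K) {Ω : Type*}
    [MeasurableSpace Ω] {P : Measure Ω} [IsProbabilityMeasure P] {X : ℕ → Fin K → Ω → ℝ}
    (hδ : 0 < δ) (hδ1 : δ < 1) (hν : IsOneSubGaussian ν) (hX : IsCleanBandit ν P X) :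
    ENNReal.ofReal (1 - δ) ≤
      P {ω | cleanPulls δ (fun t a => (∑ j ∈ Finset.range t, X j a ω) / t) ≤
        pullComplexity δ (mean ν)} := by
  refine (ofReal_one_sub_le_measure_of_tail hK hδ P _
    (fun a r => clean_tail_le hδ hδ1 hν hX a r)).trans (measure_mono fun ω hω => ?_)
  refine cleanPulls_le_pullComplexity fun a t ht => ?_
  obtain ⟨r, rfl⟩ : ∃ r, t = r + 1 := ⟨t - 1, by omega⟩
  exact not_lt.1 (hω a r)

/-! ### Zero-error packets -/

lemma typewriter_pos_iff {K : ℕ} [NeZero K] {ε : ℝ} (h0 : 0 < ε) (h1 : ε < 1) (x y : Fin K) :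
    0 < typewriter K ε x y ↔ y = x ∨ y = x + 1 := by
  unfold typewriter
  have : 0 < 1 - ε := by linarith
  split_ifs with hx hy hy
  · exact iff_of_true (by linarith) (Or.inl hx)
  · exact iff_of_true (by linarith) (Or.inl hx)
  · exact iff_of_true (by linarith) (Or.inr hy)
  · exact iff_of_false (by simp) (by tauto)

lemma confusabilityGraph_typewriter {n : ℕ} {ε : ℝ} (h0 : 0 < ε) (h1 : ε < 1) :
    confusabilityGraph (typewriter (n + 2) ε) = SimpleGraph.cycleGraph (n + 2) := by
  ext x x'
  rw [SimpleGraph.cycleGraph_adj]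
  simp only [confusabilityGraph, typewriter_pos_iff h0 h1]
  constructor
  · rintro ⟨hne, y, rfl | rfl, h | h⟩
    · exact absurd h hne
    · left; rw [h]; abel
    · right; rw [← h]; abel
    · exact absurd (add_right_cancel h) hne
  · rintro (h | h)
    · have hx : x = x' + 1 := by rw [← h]; abel
      refine ⟨fun e => ?_, x, Or.inl rfl, Or.inr hx⟩
      rw [e, sub_self] at h
      exact zero_ne_one h
    · have hx : x' = x + 1 := by rw [← h]; abel
      refine ⟨fun e => ?_, x', Or.inr hx, Or.inl rfl⟩
      rw [e, sub_self] at h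
      exact zero_ne_one h

lemma card_plan (K : ℕ) : Fintype.card (Plan K) = 2 ^ K - 1 := by
  have h : Fintype.card (Plan K) = Fintype.card {S : Finset (Fin K) // S ≠ ∅} :=
    Fintype.card_congr (Equiv.subtypeEquivRight fun S => Finset.nonempty_iff_ne_empty)
  rw [h, Fintype.card_subtype_compl]
  simp

/-- The codewords of a zero-error packet form an independent set of the strong power. -/
lemma PacketCode.ZeroError.card_le_indepNum {K : ℕ} {c : PacketCode K} {W : Fin K → Fin K → ℝ}
    (hc : c.ZeroError W) (hW : ∀ x, ∃ y, 0 < W x y) :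
    Fintype.card (Plan K) ≤ (strongPower (confusabilityGraph W) c.length).indepNum := by
  classical
  -- Codewords that are confusable in every coordinate share a possible output block, which the
  -- decoder would have to map to both plans. Where the coordinates agree, `hW` supplies the common
  -- output.
  have key : ∀ p q : Plan K,
      (∀ i, c.enc 0 p i = c.enc 0 q i ∨ (confusabilityGraph W).Adj (c.enc 0 p i) (c.enc 0 q i)) →
      p = q := by
    intro p q h
    have hy : ∀ i, ∃ y, 0 < W (c.enc 0 p i) y ∧ 0 < W (c.enc 0 q i) y := fun i => by
      rcases h i with h | h
      · obtain ⟨y, hy⟩ := hW (c.enc 0 p i)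
        exact ⟨y, hy, h ▸ hy⟩
      · exact h.2
    choose y hy using hy
    rw [← hc 0 p y fun i => (hy i).1, ← hc 0 q y fun i => (hy i).2]
  have hinj : Function.Injective (c.enc 0) := fun p q h => key p q fun i => Or.inl (congrFun h i)
  have hind : (strongPower (confusabilityGraph W) c.length).IsIndepSet
      (Finset.univ.image (c.enc 0) : Finset (Fin c.length → Fin K)) := by
    rintro _ hx _ hy - hadj
    simp only [Finset.coe_image, Finset.coe_univ, Set.image_univ, Set.mem_range] at hx hy
    obtain ⟨p, rfl⟩ := hx
    obtain ⟨q, rfl⟩ := hy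
    exact hadj.1 (congrArg _ (key p q hadj.2))
  have := hind.card_le_indepNum
  rwa [Finset.card_image_of_injective _ hinj, Finset.card_univ] at this

lemma sum_digits (b n L : ℕ) : ∑ j ∈ Finset.range L, n / b ^ j % b * b ^ j = n % b ^ L := by
  induction L with
  | zero => simp [Nat.mod_one]
  | succ L ih =>
    rw [Finset.sum_range_succ, ih, pow_succ, Nat.mod_mul]
    ring

lemma planOfDigits_digit {K : ℕ} [NeZero K] (e : Plan K ≃ Fin (Fintype.card (Plan K))) {b L : ℕ}
    (h : Fintype.card (Plan K) ≤ b ^ L) (p : Plan K) {d : Fin L → ℕ}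
    (hd : ∀ j, d j = digit e b p j) : planOfDigits e b d = p := by
  have hsum : ∑ j, d j * b ^ j.val = (e p).val := by
    simp only [hd, digit]
    rw [Fin.sum_univ_eq_sum_range (fun j => (e p).val / b ^ j % b * b ^ j), sum_digits,
      Nat.mod_eq_of_lt ((e p).2.trans_le h)]
  unfold planOfDigits
  rw [dif_pos (by rw [hsum]; exact (e p).2)]
  rw [Equiv.symm_apply_eq]
  exact Fin.ext hsum

lemma le_pow_ceil_logb {b n : ℕ} (hb : 1 < b) (hn : 0 < n) : n ≤ b ^ ⌈Real.logb b n⌉₊ := by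
  have hb' : (1 : ℝ) < b := by exact_mod_cast hb
  have h := Nat.le_ceil (Real.logb b n)
  rw [Real.logb_le_iff_le_rpow hb' (by exact_mod_cast hn), Real.rpow_natCast] at h
  exact_mod_cast h

lemma ceil_logb_eq {b n k : ℕ} (hb : 1 < b) (h1 : b ^ k < n) (h2 : n ≤ b ^ (k + 1)) :
    ⌈Real.logb b n⌉₊ = k + 1 := by
  have hb' : (1 : ℝ) < b := by exact_mod_cast hb
  have hn : (0 : ℝ) < n := by exact_mod_cast (Nat.zero_le _).trans_lt h1
  rw [Nat.ceil_eq_iff (by omega), Nat.add_sub_cancel, Real.lt_logb_iff_rpow_lt hb' hn,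
    Real.logb_le_iff_le_rpow hb' hn, Real.rpow_natCast, Real.rpow_natCast]
  constructor
  · exact_mod_cast h1
  · exact_mod_cast h2

lemma slopeDec_slope : ∀ d y₁ y₂ : Fin 5, (y₁ = slope d false ∨ y₁ = slope d false + 1) →
    (y₂ = slope d true ∨ y₂ = slope d true + 1) → slopeDec y₁ y₂ = d := by
  decide

lemma slopePacket_zeroError {ε : ℝ} (h0 : 0 < ε) (h1 : ε < 1)
    (e : Plan 5 ≃ Fin (Fintype.card (Plan 5))) :
    (slopePacket e).ZeroError (typewriter 5 ε) := by
  intro s p y hy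
  simp only [typewriter_pos_iff h0 h1] at hy
  refine planOfDigits_digit e ?_ p fun j => ?_
  · have := le_pow_ceil_logb (b := 5) (n := Fintype.card (Plan 5)) (by norm_num)
      (Fintype.card_pos_iff.2 ⟨p⟩)
    exact_mod_cast this
  · have hfst := hy ⟨2 * j.val, by have := j.2; simp only [slopePacket]; omega⟩
    have hsnd := hy ⟨2 * j.val + 1, by have := j.2; simp only [slopePacket]; omega⟩
    simp only [slopePacket, Nat.mul_mod_right, Nat.mul_div_cancel_left j.val two_pos,
      show (2 * j.val + 1) / 2 = j.val by omega, show (2 * j.val + 1) % 2 = 1 by omega,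
      zero_ne_one, decide_true, decide_false] at hfst hsnd
    rw [slopeDec_slope _ _ _ hfst hsnd, Fin.val_ofNat]
    exact Nat.mod_eq_of_lt (Nat.mod_lt _ (by norm_num))

lemma calendarEnc_val (t d : ℕ) : (calendarEnc t d).val = 2 * (d % 3) + t % 2 := by
  simp only [calendarEnc, Fin.ofNat]
  omega

lemma calendarEnc_mem (t d : ℕ) : calendarEnc t d ∈ calendar t := by
  simp only [calendar, Finset.mem_filter, Finset.mem_univ, true_and, calendarEnc_val]
  omega

/-- A shift by one changes parity, also across the wrap from 5 to 0 because 6 is even. The parity of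
the output relative to the slot thus reveals whether the channel has shifted the input. -/
lemma calendarDec_calendarEnc {t d : ℕ} {y : Fin 6}
    (hy : y = calendarEnc t d ∨ y = calendarEnc t d + 1) : calendarDec t y = d % 3 := by
  have hx := calendarEnc_val t d
  have hmem := calendarEnc_mem t d
  unfold calendarDec
  rcases hy with rfl | rfl
  · rw [if_pos hmem, hx]
    omega
  · rw [if_neg, add_sub_cancel_right, hx]
    · omega
    · simp only [calendar, Finset.mem_filter, Finset.mem_univ, true_and, Fin.val_add, hx]
      rw [show ((1 : Fin 6) : ℕ) = 1 from rfl]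
      omega

lemma calendarPacket_zeroError {ε : ℝ} (h0 : 0 < ε) (h1 : ε < 1)
    (e : Plan 6 ≃ Fin (Fintype.card (Plan 6))) :
    (calendarPacket e).ZeroError (typewriter 6 ε) := by
  intro s p y hy
  simp only [typewriter_pos_iff h0 h1] at hy
  refine planOfDigits_digit e ?_ p fun j => ?_
  · have := le_pow_ceil_logb (b := 3) (n := Fintype.card (Plan 6)) (by norm_num)
      (Fintype.card_pos_iff.2 ⟨p⟩)
    exact_mod_cast this
  · rw [calendarDec_calendarEnc (hy j)]
    exact Nat.mod_eq_of_lt (Nat.mod_lt _ (by norm_num))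

lemma ceil_logb_five : ⌈Real.logb 5 (2 ^ 5)⌉₊ = 3 := by
  -- `5 ^ 2 < 32 ≤ 5 ^ 3`.
  have := ceil_logb_eq (b := 5) (n := 32) (k := 2) (by norm_num) (by norm_num) (by norm_num)
  norm_num at this ⊢
  exact this

lemma ceil_logb_three : ⌈Real.logb 3 (2 ^ 6)⌉₊ = 4 := by
  -- `3 ^ 3 < 64 ≤ 3 ^ 4`.
  have := ceil_logb_eq (b := 3) (n := 64) (k := 3) (by norm_num) (by norm_num) (by norm_num)
  norm_num at this ⊢
  exact this

lemma ceil_logb_card_plan_le (K : ℕ) {b : ℝ} (hb : 1 < b) :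
    ⌈Real.logb b (Fintype.card (Plan K))⌉₊ ≤ ⌈Real.logb b (2 ^ K)⌉₊ := by
  rcases Nat.eq_zero_or_pos (Fintype.card (Plan K)) with h | h
  · simp [h]
  · refine Nat.ceil_le_ceil (Real.logb_le_logb_of_le hb (by exact_mod_cast h) ?_)
    rw [card_plan]
    exact_mod_cast Nat.sub_le _ _

/-! ### The execution segment -/

/-- The rounds of an execution segment with active set `S` and budget `m` in which `a` is pulled. -/
def slots {K : ℕ} (S : Finset (Fin K)) (m : ℕ) (a : Fin K) : Finset ℕ :=
  if h : S.Nonempty then (Finset.range (S.card * m)).filter fun j => planArm ⟨S, h⟩ m j = a else ∅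

/-- The quotient `j / m` is constant on each of the `c` consecutive blocks of length `m`. -/
lemma card_filter_div (p : ℕ → Prop) [DecidablePred p] (c m : ℕ) :
    ((Finset.range (c * m)).filter fun j => p (j / m)).card =
      m * ((Finset.range c).filter p).card := by
  rcases Nat.eq_zero_or_pos m with rfl | hm
  · simp
  simp only [Finset.card_filter]
  induction c with
  | zero => simp
  | succ c ih =>
    rw [Nat.succ_mul, Finset.sum_range_add, ih, Finset.sum_range_succ, mul_add]
    congr 1
    rw [Finset.sum_congr rfl (g := fun _ => if p c then 1 else 0), Finset.sum_const,
      Finset.card_range, smul_eq_mul]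
    intro j hj
    have : (c * m + j) / m = c := by
      rw [mul_comm, Nat.mul_add_div hm, Nat.div_eq_of_lt (Finset.mem_range.1 hj), add_zero]
    rw [this]

lemma card_slots {K : ℕ} {S : Finset (Fin K)} {a : Fin K} (ha : a ∈ S) (m : ℕ) :
    (slots S m a).card = m := by
  have hS : S.Nonempty := ⟨a, ha⟩
  rw [slots, dif_pos hS]
  unfold planArm
  rw [card_filter_div (fun i => (S.sort (· ≤ ·)).getD i (S.max' hS) = a)]
  have hlen : (S.sort (· ≤ ·)).length = S.card := Finset.length_sort _
  have hmem : a ∈ S.sort (· ≤ ·) := (Finset.mem_sort _).2 ha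
  have hone : (Finset.range S.card).filter (fun i => (S.sort (· ≤ ·)).getD i (S.max' hS) = a) =
      {(S.sort (· ≤ ·)).idxOf a} := by
    ext i
    simp only [Finset.mem_filter, Finset.mem_range, Finset.mem_singleton]
    constructor
    · rintro ⟨hi, h⟩
      rw [List.getD_eq_getElem _ _ (hlen ▸ hi)] at h
      rw [← h, (Finset.sort_nodup _ _).idxOf_getElem]
    · rintro rfl
      have hi := List.idxOf_lt_length_iff.2 hmem
      refine ⟨hlen ▸ hi, ?_⟩
      rw [List.getD_eq_getElem _ _ hi, List.getElem_idxOf]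
  rw [hone, Finset.card_singleton, mul_one]

/-! ### The run over a channel without errors -/

variable {K : ℕ} {δ : ℝ} {code : ℕ → PacketCode K} {h₀ : Fin K}

/-- Every packet is decoded correctly if the channel makes no errors. -/
def Faithful (code : ℕ → PacketCode K) : Prop :=
  ∀ r s p, (code r).dec s ((code r).enc s p) = p

/-- The run in which the channel makes no errors. -/
def cleanRun (δ : ℝ) (code : ℕ → PacketCode K) (h₀ : Fin K) (x : ℕ → Fin K → ℝ) : ℕ → State K :=
  run δ code h₀ (fun _ a => a) x

/-- The totals of counted rewards after a phase. -/
def nextTotal (code : ℕ → PacketCode K) (x : ℕ → Fin K → ℝ) (p k : ℕ) (S : Finset (Fin K))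
    (total : Fin K → ℝ) (a : Fin K) : ℝ :=
  total a + ∑ j ∈ slots S (2 ^ p) a, x (k + (code (p + 1)).length + j) a

/-- The output sequence enters a phase only through the decoded plan, which is correct in both runs.
From here on the state is a function of the rewards alone. -/
lemma run_eq_cleanRun {W : Fin K → Fin K → ℝ} (hz : ∀ r, (code r).ZeroError W)
    (hf : Faithful code) {y : ℕ → Fin K → Fin K} (hy : ∀ t a, 0 < W a (y t a))
    (x : ℕ → Fin K → ℝ) (r : ℕ) : run δ code h₀ y x r = cleanRun δ code h₀ x r := by
  induction r with
  | zero => rfl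
  | succ r ih =>
    unfold cleanRun at ih ⊢
    rw [run, run, ih]
    generalize run δ code h₀ (fun _ a => a) x r = st
    unfold phaseStep
    split_ifs with h
    · have h1 : ∀ p, (code (st.phases + 1)).dec st.rounds (fun i => y (st.rounds + i.val)
          ((code (st.phases + 1)).enc st.rounds p i)) = p := fun p =>
        hz _ _ _ _ fun i => hy _ _
      have h2 : ∀ p, (code (st.phases + 1)).dec st.rounds (fun i =>
          ((code (st.phases + 1)).enc st.rounds p i)) = p := fun p => hf _ _ _
      simp only [h1, h2]
    · rfl

lemma phaseStep_of_lt (hf : Faithful code) (x : ℕ → Fin K → ℝ) {st : State K}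
    (h : 1 < st.active.card) :
    (phaseStep δ code (fun _ a => a) x st).phases = st.phases + 1 ∧
    (phaseStep δ code (fun _ a => a) x st).rounds =
      st.rounds + (code (st.phases + 1)).length + st.active.card * 2 ^ st.phases ∧
    (phaseStep δ code (fun _ a => a) x st).total =
      nextTotal code x st.phases st.rounds st.active st.total ∧
    (phaseStep δ code (fun _ a => a) x st).active =
      eliminate δ (2 ^ (st.phases + 1) - 1)
        (fun a => nextTotal code x st.phases st.rounds st.active st.total a /
          (2 ^ (st.phases + 1) - 1 : ℕ)) st.active := by
  have h2 : ∀ p, (code (st.phases + 1)).dec st.rounds (fun i =>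
      ((code (st.phases + 1)).enc st.rounds p i)) = p := fun p => hf _ _ _
  have hne : st.active.Nonempty := Finset.card_pos.mp (by omega)
  have htot : ∀ a, (st.total a + ∑ j ∈ Finset.range (st.active.card * 2 ^ st.phases),
      if planArm ⟨st.active, hne⟩ (2 ^ st.phases) j = a then
        x (st.rounds + ((code (st.phases + 1)).length + j))
          (planArm ⟨st.active, hne⟩ (2 ^ st.phases) j) else 0) =
      nextTotal code x st.phases st.rounds st.active st.total a := by
    intro a
    rw [nextTotal, slots, dif_pos hne, Finset.sum_filter]
    congr 1
    refine Finset.sum_congr rfl fun j _ => ?_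
    split_ifs with hj
    · rw [hj, add_assoc]
    · rfl
  unfold phaseStep
  rw [dif_pos h]
  simp only [h2, Nat.not_lt.2 (Nat.le_add_right _ _), if_false, Nat.add_sub_cancel_left, htot,
    and_self]

lemma cleanRun_succ (x : ℕ → Fin K → ℝ) (r : ℕ) : cleanRun δ code h₀ x (r + 1) =
    phaseStep δ code (fun _ a => a) x (cleanRun δ code h₀ x r) := rfl

lemma cleanRun_succ_of_not_lt {x : ℕ → Fin K → ℝ} {r : ℕ}
    (h : ¬ 1 < (cleanRun δ code h₀ x r).active.card) :
    cleanRun δ code h₀ x (r + 1) = cleanRun δ code h₀ x r := by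
  rw [cleanRun_succ, phaseStep, dif_neg h]

lemma active_cleanRun_succ_subset (hf : Faithful code) (x : ℕ → Fin K → ℝ) (r : ℕ) :
    (cleanRun δ code h₀ x (r + 1)).active ⊆ (cleanRun δ code h₀ x r).active := by
  by_cases h : 1 < (cleanRun δ code h₀ x r).active.card
  · rw [cleanRun_succ, (phaseStep_of_lt hf x h).2.2.2]
    exact fun a ha => (mem_eliminate.1 ha).1
  · rw [cleanRun_succ_of_not_lt h]

lemma phases_cleanRun (hf : Faithful code) {x : ℕ → Fin K → ℝ} {r : ℕ}
    (h : 1 < (cleanRun δ code h₀ x r).active.card) : (cleanRun δ code h₀ x r).phases = r := by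
  induction r with
  | zero => rfl
  | succ r ih =>
    have hr := h.trans_le (Finset.card_le_card (active_cleanRun_succ_subset hf x r))
    rw [cleanRun_succ, (phaseStep_of_lt hf x hr).1, ih hr]

lemma rounds_cleanRun_succ (hf : Faithful code) {x : ℕ → Fin K → ℝ} {r : ℕ}
    (h : 1 < (cleanRun δ code h₀ x r).active.card) :
    (cleanRun δ code h₀ x (r + 1)).rounds = (cleanRun δ code h₀ x r).rounds +
      (code (r + 1)).length + (cleanRun δ code h₀ x r).active.card * 2 ^ r := by
  rw [cleanRun_succ, (phaseStep_of_lt hf x h).2.1, phases_cleanRun hf h]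

lemma total_cleanRun_succ (hf : Faithful code) {x : ℕ → Fin K → ℝ} {r : ℕ}
    (h : 1 < (cleanRun δ code h₀ x r).active.card) :
    (cleanRun δ code h₀ x (r + 1)).total = nextTotal code x r (cleanRun δ code h₀ x r).rounds
      (cleanRun δ code h₀ x r).active (cleanRun δ code h₀ x r).total := by
  rw [cleanRun_succ, (phaseStep_of_lt hf x h).2.2.1, phases_cleanRun hf h]

lemma active_cleanRun_succ (hf : Faithful code) {x : ℕ → Fin K → ℝ} {r : ℕ}
    (h : 1 < (cleanRun δ code h₀ x r).active.card) :
    (cleanRun δ code h₀ x (r + 1)).active = eliminate δ (2 ^ (r + 1) - 1)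
      (fun a => (cleanRun δ code h₀ x (r + 1)).total a / (2 ^ (r + 1) - 1 : ℕ))
      (cleanRun δ code h₀ x r).active := by
  rw [total_cleanRun_succ hf h, cleanRun_succ, (phaseStep_of_lt hf x h).2.2.2,
    phases_cleanRun hf h]

/-- The state before a phase depends only on the rewards of the rounds that precede it. -/
lemma cleanRun_congr {x x' : ℕ → Fin K → ℝ} {r : ℕ}
    (h : ∀ t < (cleanRun δ code h₀ x r).rounds, x t = x' t) :
    cleanRun δ code h₀ x r = cleanRun δ code h₀ x' r := by
  induction r with
  | zero => rfl
  | succ r ih =>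
    by_cases hc : 1 < (cleanRun δ code h₀ x r).active.card
    · have hr : (cleanRun δ code h₀ x (r + 1)).rounds = (cleanRun δ code h₀ x r).rounds +
          (code ((cleanRun δ code h₀ x r).phases + 1)).length +
          (cleanRun δ code h₀ x r).active.card * 2 ^ (cleanRun δ code h₀ x r).phases := by
        rw [cleanRun_succ, phaseStep, dif_pos hc]
      rw [hr] at h
      have ih' := ih fun t ht => h t (by omega)
      rw [cleanRun_succ, cleanRun_succ, ← ih']
      generalize cleanRun δ code h₀ x r = st at *
      have hx : ∀ (S : Plan K) (arm : ℕ → Fin K) (a : Fin K),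
          (∑ j ∈ Finset.range (st.active.card * 2 ^ st.phases),
            if planArm S (2 ^ st.phases) j = a then
              x (st.rounds + ((code (st.phases + 1)).length + j)) (arm j) else 0) =
          ∑ j ∈ Finset.range (st.active.card * 2 ^ st.phases),
            if planArm S (2 ^ st.phases) j = a then
              x' (st.rounds + ((code (st.phases + 1)).length + j)) (arm j) else 0 := by
        intro S arm a
        refine Finset.sum_congr rfl fun j hj => ?_
        have := Finset.mem_range.1 hj
        rw [h _ (by omega)]
      unfold phaseStep
      rw [dif_pos hc, dif_pos hc]
      simp only [hx]
    · rw [cleanRun_succ_of_not_lt hc] at h ⊢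
      have ih' := ih h
      rw [cleanRun_succ_of_not_lt (by rwa [← ih']), ih']

/-! ### Measurability -/

section Measurability

variable {Ω : Type*} [MeasurableSpace Ω]

lemma measurableSet_eliminate_eq {m : Ω → Fin K → ℝ} (hm : ∀ a, Measurable fun ω => m ω a)
    (t : ℕ) (S S' : Finset (Fin K)) : MeasurableSet {ω | eliminate δ t (m ω) S = S'} := by
  have hset : {ω | eliminate δ t (m ω) S = S'} =
      {ω | ∀ a, (a ∈ S ∧ ∀ b ∈ S, m ω b - radius K δ t ≤ m ω a + radius K δ t) ↔ a ∈ S'} := by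
    ext ω
    simp only [Set.mem_ofPred_eq, Finset.ext_iff, mem_eliminate]
  rw [hset]
  refine measurableSet_setOfPred.2 (Measurable.forall fun a => Measurable.iff
    (Measurable.and measurable_const (Measurable.forall fun b => Measurable.imp measurable_const
      (measurableSet_setOfPred.1 ?_))) measurable_const)
  exact measurableSet_le ((hm b).sub_const _) ((hm a).add_const _)

/-- Rounds and active set take countably many values. For each fixed pair the update is measurable
in the rewards, and a countable first coordinate makes the update jointly measurable. The new totals
come first, since the new active set is computed from them. -/
lemma measurable_cleanRun (hf : Faithful code) {X : ℕ → Fin K → Ω → ℝ}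
    (hX : ∀ t a, Measurable (X t a)) (r : ℕ) :
    (∀ k S, MeasurableSet {ω | (cleanRun δ code h₀ (fun t a => X t a ω) r).rounds = k ∧
      (cleanRun δ code h₀ (fun t a => X t a ω) r).active = S}) ∧
    ∀ a, Measurable fun ω => (cleanRun δ code h₀ (fun t a => X t a ω) r).total a := by
  induction r with
  | zero =>
    exact ⟨fun k S => MeasurableSet.const (0 = k ∧ Finset.univ = S), fun a => measurable_const⟩
  | succ r ih =>
    let _ : MeasurableSpace (Finset (Fin K)) := ⊤
    have : DiscreteMeasurableSpace (Finset (Fin K)) := ⟨fun _ => trivial⟩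
    let d : Ω → ℕ × Finset (Fin K) := fun ω =>
      ((cleanRun δ code h₀ (fun t a => X t a ω) r).rounds,
        (cleanRun δ code h₀ (fun t a => X t a ω) r).active)
    have hd : Measurable d := by
      refine measurable_to_countable' fun kS => ?_
      convert ih.1 kS.1 kS.2 using 1
      ext ω
      simp [d, Prod.ext_iff]
    let T : Fin K → (ℕ × Finset (Fin K)) × Ω → ℝ := fun a p =>
      if 1 < p.1.2.card then
        nextTotal code (fun t a => X t a p.2) r p.1.1 p.1.2
          (cleanRun δ code h₀ (fun t a => X t a p.2) r).total a
      else (cleanRun δ code h₀ (fun t a => X t a p.2) r).total a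
    have hT : ∀ a, Measurable (T a) := fun a => by
      refine measurable_from_prod_countable_right fun kS => ?_
      by_cases hc : 1 < kS.2.card
      · simp only [T, hc, if_true, nextTotal]
        exact (ih.2 a).add (Finset.measurable_sum _ fun j _ => hX _ _)
      · simp only [T, hc, if_false]
        exact ih.2 a
    have htot : ∀ ω a, (cleanRun δ code h₀ (fun t a => X t a ω) (r + 1)).total a =
        T a (d ω, ω) := fun ω a => by
      simp only [T, d]
      split_ifs with hc
      · rw [total_cleanRun_succ hf hc]
      · rw [cleanRun_succ_of_not_lt hc]
    have htot_meas : ∀ a, Measurable fun ω =>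
        (cleanRun δ code h₀ (fun t a => X t a ω) (r + 1)).total a := fun a => by
      simp only [htot]
      exact (hT a).comp (hd.prodMk measurable_id)
    refine ⟨fun k S => ?_, htot_meas⟩
    let A : (ℕ × Finset (Fin K)) × Ω → ℕ × Finset (Fin K) := fun p =>
      if 1 < p.1.2.card then
        (p.1.1 + (code (r + 1)).length + p.1.2.card * 2 ^ r,
          eliminate δ (2 ^ (r + 1) - 1) (fun a =>
            (cleanRun δ code h₀ (fun t a => X t a p.2) (r + 1)).total a /
              (2 ^ (r + 1) - 1 : ℕ)) p.1.2)
      else p.1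
    have hA : Measurable A := by
      refine measurable_from_prod_countable_right fun kS => ?_
      by_cases hc : 1 < kS.2.card
      · simp only [A, hc, if_true]
        refine measurable_const.prodMk (measurable_to_countable' fun S' => ?_)
        exact measurableSet_eliminate_eq (fun a => (htot_meas a).div_const _) _ _ _
      · simp only [A, hc, if_false]
        exact measurable_const
    have hset : {ω | (cleanRun δ code h₀ (fun t a => X t a ω) (r + 1)).rounds = k ∧
        (cleanRun δ code h₀ (fun t a => X t a ω) (r + 1)).active = S} =
        (fun ω => A (d ω, ω)) ⁻¹' {(k, S)} := by
      ext ω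
      simp only [Set.mem_ofPred_eq, Set.mem_preimage, Set.mem_singleton_iff, A, d]
      split_ifs with hc
      · rw [Prod.mk.injEq, rounds_cleanRun_succ hf hc, active_cleanRun_succ hf hc]
      · rw [Prod.mk.injEq, cleanRun_succ_of_not_lt hc]
    rw [hset]
    exact (hA.comp (hd.prodMk measurable_id)) (measurableSet_singleton _)

end Measurability

/-! ### Concentration of the counted rewards -/

section Concentration

variable {Ω : Type*} {X : ℕ → Fin K → Ω → ℝ}

/-- The arm `a` is executed in phase `r + 1`. -/
def executes (δ : ℝ) (code : ℕ → PacketCode K) (h₀ : Fin K) (X : ℕ → Fin K → Ω → ℝ) (a : Fin K)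
    (r : ℕ) : Set Ω :=
  {ω | 1 < (cleanRun δ code h₀ (fun t a => X t a ω) r).active.card ∧
    a ∈ (cleanRun δ code h₀ (fun t a => X t a ω) r).active}

/-- The number of preceding rounds is `kS.1` and the active set is `kS.2`. -/
def situation (δ : ℝ) (code : ℕ → PacketCode K) (h₀ : Fin K) (X : ℕ → Fin K → Ω → ℝ) (r : ℕ)
    (kS : ℕ × Finset (Fin K)) : Set Ω :=
  {ω | (cleanRun δ code h₀ (fun t a => X t a ω) r).rounds = kS.1 ∧
    (cleanRun δ code h₀ (fun t a => X t a ω) r).active = kS.2}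

/-- Splits the event into countably many disjoint pieces, on each of which the sampling rounds of
the phase are deterministic. -/
lemma executes_eq_iUnion (a : Fin K) (r : ℕ) : executes δ code h₀ X a r =
    ⋃ kS : {kS : ℕ × Finset (Fin K) // 1 < kS.2.card ∧ a ∈ kS.2},
      situation δ code h₀ X r kS.1 := by
  ext ω
  simp only [executes, situation, Set.mem_ofPred_eq, Set.mem_iUnion, Subtype.exists, Prod.exists]
  constructor
  · exact fun h => ⟨_, _, h, rfl, rfl⟩
  · rintro ⟨k, S, h, -, rfl⟩
    exact h

lemma executes_succ_subset (hf : Faithful code) (a : Fin K) (r : ℕ) :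
    executes δ code h₀ X a (r + 1) ⊆ executes δ code h₀ X a r := fun _ h =>
  ⟨h.1.trans_le (Finset.card_le_card (active_cleanRun_succ_subset hf _ r)),
    active_cleanRun_succ_subset hf _ r h.2⟩

variable [MeasurableSpace Ω] {P : Measure Ω} {ν : Fin K → Measure ℝ}

lemma lintegral_exp_sum_le [IsProbabilityMeasure P] (hν : IsOneSubGaussian ν)
    (hX : ∀ t a, Measurable (X t a)) (hlaw : ∀ t a, P.map (X t a) = ν a)
    (hind : iIndepFun (fun (t : ℕ) (ω : Ω) (a : Fin K) => X t a ω) P)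
    (a : Fin K) (T : Finset ℕ) (l : ℝ) :
    ∫⁻ ω, ENNReal.ofReal (Real.exp (l * ∑ t ∈ T, X t a ω)) ∂P ≤
      ENNReal.ofReal (Real.exp (T.card * (l * mean ν a + l ^ 2 / 2))) := by
  have hind' : iIndepFun (fun (t : ℕ) (ω : Ω) => X t a ω - mean ν a) P :=
    hind.comp (fun _ z => z a - mean ν a) fun _ => by fun_prop
  have hsub := HasSubgaussianMGF.sum_of_iIndepFun hind' (c := fun _ => 1) (s := T)
    fun t _ => hasSubgaussianMGF_sub_mean hν (hX t a) (hlaw t a)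
  have hfac : ∀ ω, Real.exp (l * ∑ t ∈ T, X t a ω) = Real.exp (T.card * (l * mean ν a)) *
      Real.exp (l * ∑ t ∈ T, (X t a ω - mean ν a)) := fun ω => by
    rw [← Real.exp_add, Finset.sum_sub_distrib, Finset.sum_const, nsmul_eq_mul]
    congr 1
    ring
  simp only [hfac]
  rw [← ofReal_integral_eq_lintegral_ofReal ((hsub.integrable_exp_mul l).const_mul _)
    (Filter.Eventually.of_forall fun ω => by positivity), integral_const_mul]
  refine ENNReal.ofReal_le_ofReal ?_
  have h := hsub.mgf_le l
  rw [mgf] at h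
  calc _ ≤ Real.exp (T.card * (l * mean ν a)) *
        Real.exp (((∑ _t ∈ T, 1 : NNReal) : ℝ) * l ^ 2 / 2) := by gcongr
    _ = _ := by
      rw [← Real.exp_add]
      congr 1
      simp
      ring

lemma measurableSet_situation (hf : Faithful code) (hX : ∀ t a, Measurable (X t a)) (r : ℕ)
    (kS : ℕ × Finset (Fin K)) : MeasurableSet (situation δ code h₀ X r kS) :=
  (measurable_cleanRun hf hX r).1 kS.1 kS.2

lemma lintegral_executes (hf : Faithful code) (hX : ∀ t a, Measurable (X t a)) (a : Fin K) (r : ℕ)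
    (f : Ω → ℝ≥0∞) : ∫⁻ ω in executes δ code h₀ X a r, f ω ∂P =
    ∑' kS : {kS : ℕ × Finset (Fin K) // 1 < kS.2.card ∧ a ∈ kS.2},
      ∫⁻ ω in situation δ code h₀ X r kS.1, f ω ∂P := by
  rw [executes_eq_iUnion]
  refine lintegral_iUnion (fun _ => measurableSet_situation hf hX r _) ?_ f
  intro kS kS' hne
  refine Set.disjoint_left.2 fun ω h h' => hne (Subtype.ext (Prod.ext ?_ ?_))
  · exact h.1.symm.trans h'.1
  · exact h.2.symm.trans h'.2

/-- Rewards of later rounds are independent of the state before a phase. -/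
lemma lintegral_situation_mul_le [IsProbabilityMeasure P] (hf : Faithful code)
    (hν : IsOneSubGaussian ν)
    (hX : ∀ t a, Measurable (X t a)) (hlaw : ∀ t a, P.map (X t a) = ν a)
    (hind : iIndepFun (fun (t : ℕ) (ω : Ω) (a : Fin K) => X t a ω) P)
    (a : Fin K) (r : ℕ) (kS : ℕ × Finset (Fin K)) (T : Finset ℕ) (hT : ∀ t ∈ T, kS.1 ≤ t)
    (l : ℝ) :
    ∫⁻ ω in situation δ code h₀ X r kS,
      ENNReal.ofReal (Real.exp (l * (cleanRun δ code h₀ (fun t a => X t a ω) r).total a)) *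
        ENNReal.ofReal (Real.exp (l * ∑ t ∈ T, X t a ω)) ∂P ≤
    (∫⁻ ω in situation δ code h₀ X r kS,
      ENNReal.ofReal (Real.exp (l * (cleanRun δ code h₀ (fun t a => X t a ω) r).total a)) ∂P) *
      ENNReal.ofReal (Real.exp (T.card * (l * mean ν a + l ^ 2 / 2))) := by
  classical
  -- Setting all rewards from round `kS.1` on to zero leaves the run up to this situation unchanged
  -- (`cleanRun_congr`). The event and the total thereby become functions of finitely many past
  -- rewards, independent of those in `T`.
  let past (z : Finset.range kS.1 → Fin K → ℝ) (t : ℕ) (a : Fin K) : ℝ :=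
    if h : t ∈ Finset.range kS.1 then z ⟨t, h⟩ a else 0
  let pz : ℕ → Fin K → (Finset.range kS.1 → Fin K → ℝ) → ℝ := fun t a z => past z t a
  have hpast : ∀ t a, Measurable (pz t a) := fun t a => by
    by_cases h : t ∈ Finset.range kS.1
    · simp only [pz, past, h, dif_pos]
      fun_prop
    · simp only [pz, past, h, dif_neg, not_false_eq_true]
      exact measurable_const
  let Φ : (Finset.range kS.1 → Fin K → ℝ) → ℝ≥0∞ :=
    (situation δ code h₀ pz r kS).indicator fun z =>
      ENNReal.ofReal (Real.exp (l * (cleanRun δ code h₀ (fun t a => pz t a z) r).total a))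
  have hΦ : Measurable Φ :=
    (((((measurable_cleanRun hf hpast r).2 a).const_mul l).exp).ennreal_ofReal).indicator
      (measurableSet_situation hf hpast r kS)
  let Ψ : (T → Fin K → ℝ) → ℝ≥0∞ := fun z => ENNReal.ofReal (Real.exp (l * ∑ t, z t a))
  have hΨ : Measurable Ψ := by fun_prop
  let Z : Ω → Finset.range kS.1 → Fin K → ℝ := fun ω t a => X t a ω
  have hZ : Measurable Z := by fun_prop
  let Z' : Ω → T → Fin K → ℝ := fun ω t a => X t a ω
  have hZ' : Measurable Z' := by fun_prop
  have hdisj : Disjoint (Finset.range kS.1) T := by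
    refine Finset.disjoint_left.2 fun t ht ht' => ?_
    have := Finset.mem_range.1 ht
    have := hT t ht'
    omega
  have hindep : IndepFun (Φ ∘ Z) (Ψ ∘ Z') P :=
    (hind.indepFun_finset _ _ hdisj fun t => measurable_pi_lambda _ (hX t)).comp hΦ hΨ
  have hagree : ∀ ω, ∀ t < kS.1, (fun a => X t a ω) = fun a => pz t a (Z ω) := fun ω t ht => by
    funext a
    simp only [pz, past, Finset.mem_range.2 ht, dif_pos, Z]
  have hcongr : ∀ ω, ω ∈ situation δ code h₀ X r kS →
      cleanRun δ code h₀ (fun t a => X t a ω) r =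
        cleanRun δ code h₀ (fun t a => pz t a (Z ω)) r := fun ω h =>
    cleanRun_congr fun t ht => hagree ω t (h.1 ▸ ht)
  have hcongr' : ∀ ω, Z ω ∈ situation δ code h₀ pz r kS →
      cleanRun δ code h₀ (fun t a => pz t a (Z ω)) r =
        cleanRun δ code h₀ (fun t a => X t a ω) r := fun ω h =>
    cleanRun_congr fun t ht => (hagree ω t (h.1 ▸ ht)).symm
  have hmem : ∀ ω, ω ∈ situation δ code h₀ X r kS ↔ Z ω ∈ situation δ code h₀ pz r kS := by
    intro ω
    constructor
    · intro h
      have := hcongr ω h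
      simp only [situation, Set.mem_ofPred_eq] at h ⊢
      rwa [← this]
    · intro h
      have := hcongr' ω h
      simp only [situation, Set.mem_ofPred_eq] at h ⊢
      rwa [← this]
  have hΦZ : ∀ ω, (situation δ code h₀ X r kS).indicator (fun ω =>
      ENNReal.ofReal (Real.exp (l * (cleanRun δ code h₀ (fun t a => X t a ω) r).total a))) ω =
      Φ (Z ω) := by
    intro ω
    by_cases h : ω ∈ situation δ code h₀ X r kS
    · simp only [Φ]
      rw [Set.indicator_of_mem h, Set.indicator_of_mem ((hmem ω).1 h), hcongr ω h]
    · simp only [Φ]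
      rw [Set.indicator_of_notMem h, Set.indicator_of_notMem (mt (hmem ω).2 h)]
  have hΨZ : ∀ ω, ENNReal.ofReal (Real.exp (l * ∑ t ∈ T, X t a ω)) = Ψ (Z' ω) := fun ω => by
    simp only [Ψ, Z']
    rw [← Finset.sum_coe_sort T fun t => X t a ω]
  have hmeas := measurableSet_situation (δ := δ) (h₀ := h₀) hf hX r kS
  rw [← lintegral_indicator hmeas, ← lintegral_indicator hmeas]
  simp only [Set.indicator_mul_left, hΦZ, hΨZ]
  calc ∫⁻ ω, Φ (Z ω) * Ψ (Z' ω) ∂P = (∫⁻ ω, Φ (Z ω) ∂P) * ∫⁻ ω, Ψ (Z' ω) ∂P :=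
        lintegral_mul_eq_lintegral_mul_lintegral_of_indepFun (hΦ.comp hZ) (hΨ.comp hZ') hindep
    _ ≤ _ := by
      gcongr
      simp only [← hΨZ]
      exact lintegral_exp_sum_le hν hX hlaw hind a T l

lemma lintegral_exp_total_succ_le [IsProbabilityMeasure P] (hf : Faithful code)
    (hν : IsOneSubGaussian ν)
    (hX : ∀ t a, Measurable (X t a)) (hlaw : ∀ t a, P.map (X t a) = ν a)
    (hind : iIndepFun (fun (t : ℕ) (ω : Ω) (a : Fin K) => X t a ω) P)
    (a : Fin K) (r : ℕ) (l : ℝ) :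
    ∫⁻ ω in executes δ code h₀ X a r, ENNReal.ofReal
      (Real.exp (l * (cleanRun δ code h₀ (fun t a => X t a ω) (r + 1)).total a)) ∂P ≤
    (∫⁻ ω in executes δ code h₀ X a r, ENNReal.ofReal
      (Real.exp (l * (cleanRun δ code h₀ (fun t a => X t a ω) r).total a)) ∂P) *
      ENNReal.ofReal (Real.exp ((2 ^ r : ℕ) * (l * mean ν a + l ^ 2 / 2))) := by
  rw [lintegral_executes hf hX, lintegral_executes hf hX, ← ENNReal.tsum_mul_right]
  refine ENNReal.tsum_le_tsum fun ⟨⟨k, S⟩, hc, ha⟩ => ?_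
  have hinj : Function.Injective fun j => k + (code (r + 1)).length + j := add_right_injective _
  have hcard : ((slots S (2 ^ r) a).map ⟨_, hinj⟩).card = 2 ^ r := by
    rw [Finset.card_map, card_slots ha]
  have h := lintegral_situation_mul_le (δ := δ) (h₀ := h₀) hf hν hX hlaw hind a r (k, S)
    ((slots S (2 ^ r) a).map ⟨_, hinj⟩) (fun t ht => by
      obtain ⟨j, -, rfl⟩ := Finset.mem_map.1 ht
      simp only [Function.Embedding.coeFn_mk]
      omega) l
  rw [hcard] at h
  refine le_trans (le_of_eq ?_) h
  refine setLIntegral_congr_fun (measurableSet_situation hf hX r (k, S)) fun ω hω => ?_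
  have hc' : 1 < (cleanRun δ code h₀ (fun t a => X t a ω) r).active.card := by
    rw [hω.2]; exact hc
  rw [total_cleanRun_succ hf hc', hω.1, hω.2, nextTotal, mul_add, Real.exp_add,
    ENNReal.ofReal_mul (Real.exp_pos _).le, Finset.sum_map]
  rfl

lemma lintegral_exp_total_le [IsProbabilityMeasure P] (hf : Faithful code)
    (hν : IsOneSubGaussian ν)
    (hX : ∀ t a, Measurable (X t a)) (hlaw : ∀ t a, P.map (X t a) = ν a)
    (hind : iIndepFun (fun (t : ℕ) (ω : Ω) (a : Fin K) => X t a ω) P)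
    (a : Fin K) (r : ℕ) (l : ℝ) :
    ∫⁻ ω in executes δ code h₀ X a r, ENNReal.ofReal
      (Real.exp (l * (cleanRun δ code h₀ (fun t a => X t a ω) (r + 1)).total a)) ∂P ≤
    ENNReal.ofReal (Real.exp ((2 ^ (r + 1) - 1 : ℕ) * (l * mean ν a + l ^ 2 / 2))) := by
  induction r with
  | zero =>
    refine (lintegral_exp_total_succ_le hf hν hX hlaw hind a 0 l).trans ?_
    refine (mul_le_of_le_one_left' ?_).trans_eq (by norm_num)
    calc _ = ∫⁻ ω in executes δ code h₀ X a 0, 1 ∂P := by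
          refine lintegral_congr fun ω => ?_
          change ENNReal.ofReal (Real.exp (l * 0)) = 1
          simp
      _ ≤ 1 := by simpa using prob_le_one
  | succ r ih =>
    refine (lintegral_exp_total_succ_le hf hν hX hlaw hind a (r + 1) l).trans ?_
    -- The domain of integration shrinks from phase to phase and the integrand is nonnegative, so
    -- the induction hypothesis on the larger event applies.
    refine (mul_le_mul_left (((lintegral_mono_set (executes_succ_subset hf a r)).trans ih)) _).trans ?_
    rw [← ENNReal.ofReal_mul (Real.exp_pos _).le, ← Real.exp_add, ← add_mul, ← Nat.cast_add]
    have : 2 ^ (r + 1) - 1 + 2 ^ (r + 1) = 2 ^ (r + 1 + 1) - 1 := by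
      have := one_le_two_pow_succ_sub_one r
      rw [pow_succ 2 (r + 1)]
      omega
    rw [this]

/-- Chernoff's bound with parameter `l = s * β`; the sign `s = ±1` selects the upper or the lower
tail. -/
lemma measure_total_deviation_le [IsProbabilityMeasure P] (hf : Faithful code)
    (hν : IsOneSubGaussian ν)
    (hX : ∀ t a, Measurable (X t a)) (hlaw : ∀ t a, P.map (X t a) = ν a)
    (hind : iIndepFun (fun (t : ℕ) (ω : Ω) (a : Fin K) => X t a ω) P)
    (a : Fin K) (r : ℕ) {s β : ℝ} (hs : s ^ 2 = 1) (hβ : 0 ≤ β) {t : ℕ}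
    (ht : t = 2 ^ (r + 1) - 1) :
    P ({ω | t * β ≤ s * ((cleanRun δ code h₀ (fun t a => X t a ω) (r + 1)).total a -
      t * mean ν a)} ∩ executes δ code h₀ X a r) ≤
    ENNReal.ofReal (Real.exp (-(t * β ^ 2 / 2))) := by
  set B := {ω | t * β ≤ s * ((cleanRun δ code h₀ (fun t a => X t a ω) (r + 1)).total a -
      t * mean ν a)} with hB
  have hint := lintegral_exp_total_le (δ := δ) (h₀ := h₀) hf hν hX hlaw hind a r (s * β)
  rw [← ht] at hint
  have hmarkov := mul_meas_ge_le_lintegral (μ := P.restrict (executes δ code h₀ X a r))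
    (f := fun ω => ENNReal.ofReal
      (Real.exp (s * β * (cleanRun δ code h₀ (fun t a => X t a ω) (r + 1)).total a)))
    (((measurable_cleanRun hf hX (r + 1)).2 a).const_mul _).exp.ennreal_ofReal
    (ENNReal.ofReal (Real.exp (t * β ^ 2 + s * β * (t * mean ν a))))
  have hsub : B ⊆ {ω | ENNReal.ofReal (Real.exp (t * β ^ 2 + s * β * (t * mean ν a))) ≤
      ENNReal.ofReal
        (Real.exp (s * β * (cleanRun δ code h₀ (fun t a => X t a ω) (r + 1)).total a))} := by
    intro ω hω
    refine ENNReal.ofReal_le_ofReal (Real.exp_le_exp.2 ?_)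
    have := mul_le_mul_of_nonneg_left (Set.mem_ofPred_eq ▸ hω) hβ
    linarith
  have hprod := (mul_le_mul_right ((Measure.le_restrict_apply _ _).trans (measure_mono hsub)) _).trans
    (hmarkov.trans hint)
  have hpos : 0 < Real.exp (t * β ^ 2 + s * β * (t * mean ν a)) := Real.exp_pos _
  rw [mul_comm, ← ENNReal.le_div_iff_mul_le (Or.inl (by simpa using hpos)) (Or.inl (by simp)),
    ← ENNReal.ofReal_div_of_pos hpos, ← Real.exp_sub] at hprod
  refine hprod.trans_eq ?_
  congr 2
  rw [mul_pow, hs]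
  ring

lemma counted_tail_le [IsProbabilityMeasure P] (hf : Faithful code) (hδ : 0 < δ) (hδ1 : δ < 1)
    (hν : IsOneSubGaussian ν)
    (hX : ∀ t a, Measurable (X t a)) (hlaw : ∀ t a, P.map (X t a) = ν a)
    (hind : iIndepFun (fun (t : ℕ) (ω : Ω) (a : Fin K) => X t a ω) P) (a : Fin K) (r : ℕ) :
    P ({ω | radius K δ (2 ^ (r + 1) - 1) <
        |(cleanRun δ code h₀ (fun t a => X t a ω) (r + 1)).total a / (2 ^ (r + 1) - 1 : ℕ) -
          mean ν a|} ∩ executes δ code h₀ X a r) ≤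
      ENNReal.ofReal (δ / (4 * K * ((r + 1 : ℕ) : ℝ) ^ 2)) := by
  have hK : 1 ≤ K := by have := a.2; omega
  have hK' : (0 : ℝ) < K := by exact_mod_cast hK
  -- The tail in terms of the sample count `2 ^ (r + 1) - 1` is at least as small as the one in
  -- terms of the phase number, as the union bound requires.
  have hrt : r + 1 ≤ 2 ^ (r + 1) - 1 := by
    have := Nat.lt_two_pow_self (n := r)
    rw [pow_succ]
    omega
  obtain ⟨t, ht⟩ : ∃ t, t = 2 ^ (r + 1) - 1 := ⟨_, rfl⟩
  rw [← ht] at hrt ⊢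
  have ht0 : (0 : ℝ) < t := by exact_mod_cast (by omega : 0 < t)
  have hβ := radius_nonneg K δ t
  have hup := measure_total_deviation_le (δ := δ) (h₀ := h₀) hf hν hX hlaw hind a r (s := 1)
    (by norm_num) hβ ht
  have hlo := measure_total_deviation_le (δ := δ) (h₀ := h₀) hf hν hX hlaw hind a r (s := -1)
    (by norm_num) hβ ht
  rw [exp_neg_mul_radius_sq hK hδ hδ1 (by omega)] at hup hlo
  refine (measure_mono ?_).trans ((measure_union_le _ _).trans ((add_le_add hup hlo).trans ?_))
  · rintro ω ⟨hω, hex⟩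
    have hdiv : ∀ u : ℝ, u - t * mean ν a = t * (u / t - mean ν a) := fun u => by field_simp
    simp only [Set.mem_union, Set.mem_inter_iff, Set.mem_ofPred_eq, hdiv] at hω ⊢
    rcases lt_abs.1 hω with h | h
    · exact Or.inl ⟨by nlinarith, hex⟩
    · exact Or.inr ⟨by nlinarith, hex⟩
  · rw [← ENNReal.ofReal_add (by positivity) (by positivity)]
    refine ENNReal.ofReal_le_ofReal ?_
    have hle : ((r + 1 : ℕ) : ℝ) ≤ t := by exact_mod_cast hrt
    calc _ = δ / (4 * K * (t : ℝ) ^ 2) := by field_simp; norm_num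
      _ ≤ _ := by gcongr

end Concentration

/-! ### Coupling with clean successive elimination -/

/-- The empirical means that clean successive elimination would see: those of the counted rewards
where the run provides them, and the true means elsewhere. -/
def coupledMeans (δ : ℝ) (code : ℕ → PacketCode K) (h₀ : Fin K) (x : ℕ → Fin K → ℝ)
    (μ : Fin K → ℝ) (t : ℕ) (a : Fin K) : ℝ :=
  open scoped Classical in
  if h : ∃ r, 2 ^ (r + 1) - 1 = t ∧ 1 < (cleanRun δ code h₀ x r).active.card ∧
    a ∈ (cleanRun δ code h₀ x r).active
  then (cleanRun δ code h₀ x (h.choose + 1)).total a / t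
  else μ a

/-- A sample count determines its phase, so the choice made in `coupledMeans` is unambiguous. -/
lemma two_pow_succ_sub_one_injective : Function.Injective fun r : ℕ => 2 ^ (r + 1) - 1 := by
  intro r s h
  have h1 := Nat.one_le_two_pow (n := r + 1)
  have h2 := Nat.one_le_two_pow (n := s + 1)
  have h3 : 2 ^ (r + 1) = 2 ^ (s + 1) := by simp only at h; omega
  have := Nat.pow_right_injective le_rfl h3
  omega

lemma coupledMeans_of_mem {x : ℕ → Fin K → ℝ} {μ : Fin K → ℝ} {r : ℕ} {a : Fin K}
    (hc : 1 < (cleanRun δ code h₀ x r).active.card) (ha : a ∈ (cleanRun δ code h₀ x r).active) :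
    coupledMeans δ code h₀ x μ (2 ^ (r + 1) - 1) a =
      (cleanRun δ code h₀ x (r + 1)).total a / (2 ^ (r + 1) - 1 : ℕ) := by
  have h : ∃ s, 2 ^ (s + 1) - 1 = 2 ^ (r + 1) - 1 ∧ 1 < (cleanRun δ code h₀ x s).active.card ∧
    a ∈ (cleanRun δ code h₀ x s).active := ⟨r, rfl, hc, ha⟩
  rw [coupledMeans, dif_pos h, two_pow_succ_sub_one_injective h.choose_spec.1]

lemma concentrated_coupledMeans {x : ℕ → Fin K → ℝ} {μ : Fin K → ℝ}
    (h : ∀ a r, 1 < (cleanRun δ code h₀ x r).active.card → a ∈ (cleanRun δ code h₀ x r).active →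
      |(cleanRun δ code h₀ x (r + 1)).total a / (2 ^ (r + 1) - 1 : ℕ) - μ a| ≤
        radius K δ (2 ^ (r + 1) - 1)) : Concentrated δ μ (coupledMeans δ code h₀ x μ) := by
  intro a t _
  by_cases he : ∃ r, 2 ^ (r + 1) - 1 = t ∧ 1 < (cleanRun δ code h₀ x r).active.card ∧
    a ∈ (cleanRun δ code h₀ x r).active
  · obtain ⟨r, rfl, hc, ha⟩ := he
    rw [coupledMeans_of_mem hc ha]
    exact h a r hc ha
  · rw [coupledMeans, dif_neg he, sub_self, abs_zero]
    exact radius_nonneg _ _ _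

/-- Elimination consults only the means of currently active arms at the ends of executed phases, and
there the coupled means are the counted ones. -/
lemma cleanActive_coupledMeans (hf : Faithful code) (x : ℕ → Fin K → ℝ) (μ : Fin K → ℝ) (r : ℕ) :
    cleanActive δ (coupledMeans δ code h₀ x μ) r = (cleanRun δ code h₀ x r).active := by
  induction r with
  | zero => rfl
  | succ r ih =>
    by_cases hc : 1 < (cleanRun δ code h₀ x r).active.card
    · rw [cleanActive_succ_of_lt (ih ▸ hc), ih, active_cleanRun_succ hf hc]
      exact eliminate_congr fun a ha => coupledMeans_of_mem hc ha
    · rw [cleanActive_succ_of_not_lt (ih ▸ hc), ih, cleanRun_succ_of_not_lt hc]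

lemma rounds_cleanRun_le (hf : Faithful code) {N : ℕ} (hN : ∀ r, (code r).length ≤ N)
    (x : ℕ → Fin K → ℝ) (r : ℕ) : (cleanRun δ code h₀ x r).rounds ≤
    (∑ i ∈ Finset.range r, if 1 < (cleanRun δ code h₀ x i).active.card then
      (cleanRun δ code h₀ x i).active.card * 2 ^ i else 0) +
      N * (cleanRun δ code h₀ x r).phases := by
  induction r with
  | zero => exact Nat.zero_le _
  | succ r ih =>
    rw [Finset.sum_range_succ]
    by_cases hc : 1 < (cleanRun δ code h₀ x r).active.card
    · rw [if_pos hc, rounds_cleanRun_succ hf hc, cleanRun_succ, (phaseStep_of_lt hf x hc).1,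
        mul_add, mul_one]
      have := hN (r + 1)
      omega
    · rw [if_neg hc, cleanRun_succ_of_not_lt hc]
      exact ih

/-- On the concentration event of the counted rewards, the packetized algorithm returns the best
arm and exceeds the pull complexity by the packets only. -/
lemma cleanRun_guarantee (hf : Faithful code) (hδ : 0 < δ) (hδ1 : δ < 1) {N : ℕ}
    (hN : ∀ r, (code r).length ≤ N) {x : ℕ → Fin K → ℝ} {μ : Fin K → ℝ} {best : Fin K}
    (hbest : IsUniqueBest μ best)
    (h : ∀ a r, 1 < (cleanRun δ code h₀ x r).active.card → a ∈ (cleanRun δ code h₀ x r).active →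
      |(cleanRun δ code h₀ x (r + 1)).total a / (2 ^ (r + 1) - 1 : ℕ) - μ a| ≤
        radius K δ (2 ^ (r + 1) - 1)) :
    (∃ r, (cleanRun δ code h₀ x r).active = {best}) ∧
    (⨆ r : ℕ, ((cleanRun δ code h₀ x r).rounds : ℕ∞)) ≤
      pullComplexity δ μ + N * ⨆ r : ℕ, ((cleanRun δ code h₀ x r).phases : ℕ∞) := by
  have hm := concentrated_coupledMeans h
  constructor
  · obtain ⟨r, hr⟩ := exists_cleanActive_eq_singleton hδ hδ1 hbest hm
    exact ⟨r, by rw [← hr, cleanActive_coupledMeans hf]⟩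
  · refine iSup_le fun r => ?_
    refine (Nat.cast_le.2 (rounds_cleanRun_le hf hN x r)).trans ?_
    rw [Nat.cast_add, Nat.cast_mul]
    gcongr
    · refine le_trans ?_ (cleanPulls_le_pullComplexity hm)
      unfold cleanPulls
      simp only [cleanActive_coupledMeans hf]
      exact le_iSup (fun n : ℕ => ((∑ i ∈ Finset.range n,
        if 1 < (cleanRun δ code h₀ x i).active.card then
          (cleanRun δ code h₀ x i).active.card * 2 ^ i else 0 : ℕ) : ℕ∞)) r
    · exact le_iSup (fun r : ℕ => ((cleanRun δ code h₀ x r).phases : ℕ∞)) r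

/-- Packetized successive elimination with zero-error packets of length at most `N`. -/
theorem packetized_guarantee {W : Fin K → Fin K → ℝ} (hW : ∀ a, 0 < W a a)
    (hz : ∀ r, (code r).ZeroError W) {N : ℕ} (hN : ∀ r, (code r).length ≤ N)
    {ν : Fin K → Measure ℝ} {best : Fin K} {Ω : Type*} [MeasurableSpace Ω] {P : Measure Ω}
    [IsProbabilityMeasure P] {Y : ℕ → Fin K → Ω → Fin K} {X : ℕ → Fin K → Ω → ℝ}
    (hδ : 0 < δ) (hδ1 : δ < 1) (hν : IsOneSubGaussian ν) (hbest : IsUniqueBest (mean ν) best)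
    (hB : IsActuatedBandit W ν P Y X) :
    ENNReal.ofReal (1 - δ) ≤
      P {ω | Returns δ code h₀ (fun t x => Y t x ω) (fun t a => X t a ω) best ∧
        stoppingTime δ code h₀ (fun t x => Y t x ω) (fun t a => X t a ω) ≤
          pullComplexity δ (mean ν) +
            N * numPhases δ code h₀ (fun t x => Y t x ω) (fun t a => X t a ω)} := by
  have hf : Faithful code := fun r s p => hz r s p _ fun i => hW _
  have hind : iIndepFun (fun (t : ℕ) (ω : Ω) (a : Fin K) => X t a ω) P :=
    hB.indep_rounds.comp (fun _ p => p.2) fun _ => measurable_snd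
  have hK : 1 ≤ K := by have := best.2; omega
  -- Zero-error decoding needs possible outputs; the impossible ones form a countable union of null
  -- events, over rounds, inputs and outputs.
  have hY : ∀ᵐ ω ∂P, ∀ t a, 0 < W a (Y t a ω) := by
    refine ae_all_iff.2 fun t => ae_all_iff.2 fun a => ?_
    have : ∀ᵐ ω ∂P, ∀ y, ¬ 0 < W a y → Y t a ω ≠ y := by
      refine ae_all_iff.2 fun y => ?_
      by_cases hy : 0 < W a y
      · exact Filter.Eventually.of_forall fun ω h => absurd hy h
      · have h0 : P {ω | Y t a ω = y} = 0 := by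
          rw [hB.law_output, ENNReal.ofReal_eq_zero]
          exact not_lt.1 hy
        filter_upwards [measure_eq_zero_iff_ae_notMem.1 h0] with ω hω _ using hω
    filter_upwards [this] with ω hω
    by_contra hneg
    exact hω _ hneg rfl
  refine (ofReal_one_sub_le_measure_of_tail hK hδ P _ fun a r =>
    counted_tail_le (δ := δ) (h₀ := h₀) hf hδ hδ1 hν hB.measurable_reward hB.law_reward hind
      a r).trans (measure_mono_ae ?_)
  filter_upwards [hY] with ω hω hgood
  have h := cleanRun_guarantee (h₀ := h₀) (x := fun t a => X t a ω) hf hδ hδ1 hN hbest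
    fun a r hc ha => not_lt.1 fun hlt => hgood a r ⟨hlt, hc, ha⟩
  have hrun := run_eq_cleanRun (δ := δ) (h₀ := h₀) hz hf hω fun t a => X t a ω
  change Returns _ _ _ _ _ _ ∧ _ ≤ _
  unfold Returns stoppingTime numPhases
  simp only [hrun]
  exact h

end PSE

end

theorem mainTheorem5 :
    -- `N_SE(δ, μ)` is the pull complexity of clean phased successive elimination, and its rate
    (∃ C : ℝ, 0 < C ∧ ∀ (K : ℕ) (δ : ℝ) (μ : Fin K → ℝ) (best : Fin K),
      0 < δ → δ < 1 → PSE.IsUniqueBest μ best →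
        ((PSE.pullComplexity δ μ : ℕ∞) : ℝ≥0∞) ≤ ENNReal.ofReal (C * PSE.gapRate δ μ best)) ∧
    (∀ (K : ℕ) (δ : ℝ) (ν : Fin K → Measure ℝ) (best : Fin K)
      {Ω : Type*} [MeasurableSpace Ω] (P : Measure Ω) [IsProbabilityMeasure P]
      (X : ℕ → Fin K → Ω → ℝ),
      0 < δ → δ < 1 → PSE.IsOneSubGaussian ν → PSE.IsUniqueBest (PSE.mean ν) best →
      PSE.IsCleanBandit ν P X →
        ENNReal.ofReal (1 - δ) ≤
          P {ω | PSE.cleanPulls δ (fun t a => (∑ j ∈ Finset.range t, X j a ω) / t) ≤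
            PSE.pullComplexity δ (PSE.mean ν)}) ∧
    -- (i) `K = 5`
    (∀ ε : ℝ, 0 < ε → ε < 1 →
      PSE.confusabilityGraph (PSE.typewriter 5 ε) = SimpleGraph.cycleGraph 5 ∧
      Fintype.card (PSE.Plan 5) ≤ 2 ^ 5 - 1 ∧
      (∀ e : PSE.Plan 5 ≃ Fin (Fintype.card (PSE.Plan 5)),
        (PSE.slopePacket e).ZeroError (PSE.typewriter 5 ε) ∧
        Fintype.card (PSE.Plan 5) ≤
          (PSE.strongPower (SimpleGraph.cycleGraph 5) (PSE.slopePacket e).length).indepNum ∧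
        (PSE.slopePacket e).length = 2 * ⌈Real.logb 5 (Fintype.card (PSE.Plan 5))⌉₊ ∧
        (PSE.slopePacket e).length ≤ 2 * ⌈Real.logb 5 (2 ^ 5)⌉₊ ∧
        2 * ⌈Real.logb 5 (2 ^ 5)⌉₊ = 6) ∧
      (∀ (δ : ℝ) (ν : Fin 5 → Measure ℝ) (best h₀ : Fin 5)
        (e : ℕ → (PSE.Plan 5 ≃ Fin (Fintype.card (PSE.Plan 5))))
        {Ω : Type*} [MeasurableSpace Ω] (P : Measure Ω) [IsProbabilityMeasure P]
        (Y : ℕ → Fin 5 → Ω → Fin 5) (X : ℕ → Fin 5 → Ω → ℝ),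
        0 < δ → δ < 1 → PSE.IsOneSubGaussian ν → PSE.IsUniqueBest (PSE.mean ν) best →
        PSE.IsActuatedBandit (PSE.typewriter 5 ε) ν P Y X →
          ENNReal.ofReal (1 - δ) ≤
            P {ω | PSE.Returns δ (fun r => PSE.slopePacket (e r)) h₀
                (fun t x => Y t x ω) (fun t a => X t a ω) best ∧
              PSE.stoppingTime δ (fun r => PSE.slopePacket (e r)) h₀
                  (fun t x => Y t x ω) (fun t a => X t a ω) ≤
                PSE.pullComplexity δ (PSE.mean ν) +
                  6 * PSE.numPhases δ (fun r => PSE.slopePacket (e r)) h₀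
                    (fun t x => Y t x ω) (fun t a => X t a ω)})) ∧
    -- (ii) `K = 6`
    (∀ ε : ℝ, 0 < ε → ε < 1 →
      PSE.confusabilityGraph (PSE.typewriter 6 ε) = SimpleGraph.cycleGraph 6 ∧
      Fintype.card (PSE.Plan 6) ≤ 2 ^ 6 - 1 ∧
      (∀ e : PSE.Plan 6 ≃ Fin (Fintype.card (PSE.Plan 6)),
        (∀ s p i, (PSE.calendarPacket e).enc s p i ∈ PSE.calendar (s + i.val)) ∧
        (PSE.calendarPacket e).ZeroError (PSE.typewriter 6 ε) ∧
        Fintype.card (PSE.Plan 6) ≤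
          (PSE.strongPower (SimpleGraph.cycleGraph 6) (PSE.calendarPacket e).length).indepNum ∧
        (PSE.calendarPacket e).length = ⌈Real.logb 3 (Fintype.card (PSE.Plan 6))⌉₊ ∧
        (PSE.calendarPacket e).length ≤ ⌈Real.logb 3 (2 ^ 6)⌉₊ ∧
        ⌈Real.logb 3 (2 ^ 6)⌉₊ = 4) ∧
      (∀ (δ : ℝ) (ν : Fin 6 → Measure ℝ) (best h₀ : Fin 6)
        (e : ℕ → (PSE.Plan 6 ≃ Fin (Fintype.card (PSE.Plan 6))))
        {Ω : Type*} [MeasurableSpace Ω] (P : Measure Ω) [IsProbabilityMeasure P]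
        (Y : ℕ → Fin 6 → Ω → Fin 6) (X : ℕ → Fin 6 → Ω → ℝ),
        0 < δ → δ < 1 → PSE.IsOneSubGaussian ν → PSE.IsUniqueBest (PSE.mean ν) best →
        PSE.IsActuatedBandit (PSE.typewriter 6 ε) ν P Y X →
          ENNReal.ofReal (1 - δ) ≤
            P {ω | PSE.Returns δ (fun r => PSE.calendarPacket (e r)) h₀
                (fun t x => Y t x ω) (fun t a => X t a ω) best ∧
              PSE.stoppingTime δ (fun r => PSE.calendarPacket (e r)) h₀
                  (fun t x => Y t x ω) (fun t a => X t a ω) ≤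
                PSE.pullComplexity δ (PSE.mean ν) +
                  4 * PSE.numPhases δ (fun r => PSE.calendarPacket (e r)) h₀
                    (fun t x => Y t x ω) (fun t a => X t a ω)})) := by
  refine ⟨⟨6656, by norm_num, fun K δ μ best hδ hδ1 hbest => PSE.pullComplexity_le hδ hδ1 hbest⟩,
    ?_, ?_, ?_⟩
  · intro K δ ν best Ω _ P _ X hδ hδ1 hν _ hX
    exact PSE.clean_guarantee (by have := best.2; omega) hδ hδ1 hν hX
  · intro ε h0 h1
    have hgraph : PSE.confusabilityGraph (PSE.typewriter 5 ε) = SimpleGraph.cycleGraph 5 :=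
      PSE.confusabilityGraph_typewriter h0 h1
    have hW : ∀ a, 0 < PSE.typewriter 5 ε a a := fun a =>
      (PSE.typewriter_pos_iff h0 h1 a a).2 (Or.inl rfl)
    have hlen := Nat.mul_le_mul_left 2
      (PSE.ceil_logb_card_plan_le 5 (b := 5) (by norm_num))
    refine ⟨hgraph, (PSE.card_plan 5).le, fun e => ⟨PSE.slopePacket_zeroError h0 h1 e, ?_, rfl,
      hlen, by rw [PSE.ceil_logb_five]⟩, ?_⟩
    · rw [← hgraph]
      exact (PSE.slopePacket_zeroError h0 h1 e).card_le_indepNum fun x => ⟨x, hW x⟩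
    · intro δ ν best h₀ e Ω _ P _ Y X hδ hδ1 hν hbest hB
      exact PSE.packetized_guarantee (N := 6) hW
        (fun r => PSE.slopePacket_zeroError h0 h1 (e r))
        (fun r => hlen.trans_eq (by rw [PSE.ceil_logb_five])) hδ hδ1 hν hbest hB
  · intro ε h0 h1
    have hgraph : PSE.confusabilityGraph (PSE.typewriter 6 ε) = SimpleGraph.cycleGraph 6 :=
      PSE.confusabilityGraph_typewriter h0 h1
    have hW : ∀ a, 0 < PSE.typewriter 6 ε a a := fun a =>
      (PSE.typewriter_pos_iff h0 h1 a a).2 (Or.inl rfl)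
    have hlen := PSE.ceil_logb_card_plan_le 6 (b := 3) (by norm_num)
    refine ⟨hgraph, (PSE.card_plan 6).le, fun e => ⟨fun s p i => PSE.calendarEnc_mem _ _,
      PSE.calendarPacket_zeroError h0 h1 e, ?_, rfl, hlen, PSE.ceil_logb_three⟩, ?_⟩
    · rw [← hgraph]
      exact (PSE.calendarPacket_zeroError h0 h1 e).card_le_indepNum fun x => ⟨x, hW x⟩
    · intro δ ν best h₀ e Ω _ P _ Y X hδ hδ1 hν hbest hB
      exact PSE.packetized_guarantee (N := 4) hW
        (fun r => PSE.calendarPacket_zeroError h0 h1 (e r))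
        (fun r => hlen.trans_eq PSE.ceil_logb_three) hδ hδ1 hν hbest hB
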